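/- Let $G$ be a finite group and let $\sigma$ be an involution of the rational group algebra $\mathbb{Q}G$, i.e. an additive map with $\sigma(xy)=\sigma(y)\sigma(x)$ and $\sigma^2=\mathrm{id}$. For a ring $A$ with involution $\sigma$ write $A_\sigma^-=\{x\in A:\sigma(x)=-x\}$, and, when $A$ is a $\mathbb{Q}$-algebra, regard it as a Lie algebra over $\mathbb{Q}$ with bracket $[x,y]=xy-yx$. Let $\hat G$ be a complete list of the simple left $\mathbb{Q}G$-modules, one from each isomorphism class. For $V\in\hat G$ let $D=D_V$ be its division algebra of $\mathbb{Q}G$-endomorphisms (the opposite algebra, if $D$ is to act on the right), and let $Z=Z_V$ be the centre of $\mathrm{End}_D(V)$. Then $\hat G$ is finite, the action on the modules $V$ gives an isomorphism of $\mathbb{Q}$-algebras $$\mathbb{Q}G\;\simeq\;\bigoplus_{V\in\hat G}\mathrm{End}_D(V),$$ each block $\mathrm{End}_D(V)$ is simple with $\dim_Z\mathrm{End}_D(V)=n^2$ for an integer $n=n_V\ge 1$ (its degree), and for each $V$ there is exactly one $V^{op}\in\hat G$ with $\sigma(\mathrm{End}_D(V))=\mathrm{End}_{D'}(V^{op})$,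 where $D'=D_{V^{op}}$ and blocks are regarded as ideals of $\mathbb{Q}G$. (a) Suppose that $V^{op}=V$, so that $\sigma$ restricts to an involution of $\mathrm{End}_D(V)$, and put $F=\{z\in Z:\sigma(z)=z\}$. Call $V$ of orthogonal (respectively symplectic) type if $\sigma$ is the identity on $Z$ and, over some splitting field $L\supseteq Z$ of $\mathrm{End}_D(V)$, for some isomorphism of $L$-algebras $L\otimes_Z\mathrm{End}_D(V)\simeq\mathrm{End}_L(W)$, the involution $\mathrm{id}\otimes\sigma$ is the adjoint involution of a nonsingular symmetric (respectively skew-symmetric) bilinear form on $W$; call $V$ of unitary type if $\sigma$ is not the identity on $Z$. Then $V$ is of one of these types; the type is orthogonal if and only if $\dim_F\mathrm{End}_D(V)_\sigma^-=n(n-1)/2$, symplectic if and only if $\dim_F\mathrm{End}_D(V)_\sigma^-=n(n+1)/2$ and $n$ is even, and unitary if and only if $\dim_F\mathrm{End}_D(V)_\sigma^-=n^2$. (In the first two cases $F=Z$.) (b) Suppose that $V^{op}\ne V$. Then $\mathrm{End}_{D'}(V^{op})$ is isomorphic, as a ring, to the opposite ring of $\mathrm{End}_D(V)$, and it has the same degree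 $n$. Let $B=\mathrm{End}_D(V)\times\mathrm{End}_{D'}(V^{op})$ with the restriction of $\sigma$, and let $F$ be the ring of central elements of $B$ fixed by $\sigma$. The projection $B\to\mathrm{End}_D(V)$ maps $F$ bijectively onto $Z$ and $B_\sigma^-$ isomorphically, as a Lie algebra, onto $\mathrm{End}_D(V)$; and $\dim_F B_\sigma^-=n^2$. (c) Let $\mathfrak{o}(V)$, $\mathfrak{sp}(V)$ and $\mathfrak{gl}(V)$ denote the Lie algebra $\mathrm{End}_D(V)_\sigma^-$ for $V^{op}=V$ of orthogonal, symplectic and unitary type respectively, let $\mathfrak{gl}(V)$ also denote $B_\sigma^-$ in case (b), and let $\hat G_o$, $\hat G_{sp}$ and $\hat G_u$ be the corresponding subsets of $\hat G$ (the modules of case (b) belong to $\hat G_u$). Then, for every choice of one module from each pair $\{V,V^{op}\}$ with $V^{op}\neq V$, the projections to the blocks give an isomorphism of Lie algebras over $\mathbb{Q}$ $$\mathbb{Q}G_\sigma^-\;\simeq\;\bigoplus_{V\in\hat G_o}\mathfrak{o}(V)\;\oplus\;\bigoplus_{V\in\hat G_{sp}}\mathfrak{sp}(V)\;\oplus\;\bigoplus_{V\in\hat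 G_u}{}^{'}\mathfrak{gl}(V),$$ where the prime means that only the chosen module of each such pair $\{V,V^{op}\}$ contributes a summand. -/

import Mathlib

open scoped TensorProduct DirectSum

universe u

attribute [local instance 100] LieRing.ofAssociativeRing

namespace SkewGroupAlgebra

section Involution

/-!
### Rings with involution

An involution of a ring `R` is a `RingInvo R`: an additive, anti-multiplicative bijection of order
dividing two, written as a ring isomorphism `R ≃+* Rᵐᵒᵖ`.
-/

/-- The value `σ x ∈ R` of an involution `σ` of `R`. -/
abbrev app {R : Type*} [Ring R] (σ : RingInvo R) (x : R) : R := (σ x).unop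

theorem app_add {R : Type*} [Ring R] (σ : RingInvo R) (x y : R) :
    app σ (x + y) = app σ x + app σ y := by
  simp [app, map_add]

theorem app_mul {R : Type*} [Ring R] (σ : RingInvo R) (x y : R) :
    app σ (x * y) = app σ y * app σ x := by
  simp [app, map_mul]

theorem app_app {R : Type*} [Ring R] (σ : RingInvo R) (x : R) : app σ (app σ x) = x :=
  σ.involution x

theorem app_zero {R : Type*} [Ring R] (σ : RingInvo R) : app σ 0 = 0 := by simp [app]

theorem app_one {R : Type*} [Ring R] (σ : RingInvo R) : app σ 1 = 1 := by simp [app]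

theorem app_neg {R : Type*} [Ring R] (σ : RingInvo R) (x : R) : app σ (-x) = -app σ x := by
  simp [app, map_neg]

/-- An involution from a function with the three defining properties. -/
def ofFun {R : Type*} [Ring R] (f : R → R) (hadd : ∀ x y, f (x + y) = f x + f y)
    (hmul : ∀ x y, f (x * y) = f y * f x) (hinv : ∀ x, f (f x) = x) : RingInvo R where
  toFun x := MulOpposite.op (f x)
  invFun x := f x.unop
  left_inv x := hinv x
  right_inv x := by simp [hinv]
  map_mul' x y := by simp [hmul]
  map_add' x y := by simp [hadd]
  involution' x := hinv x

/-- Transport of an involution along a ring isomorphism `e : R ≃+* S`: the involution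
`e ∘ σ ∘ e⁻¹` of `S`. -/
def transport {R S : Type*} [Ring R] [Ring S] (e : R ≃+* S) (σ : RingInvo R) : RingInvo S :=
  ofFun (fun x => e (app σ (e.symm x)))
    (fun x y => by simp [app_add]) (fun x y => by simp [app_mul]) (fun x => by simp)

/-- The Lie algebra over `ℚ` of skew-symmetric elements `{x | σ x = -x}`, with the bracket
`⁅x, y⁆ = x * y - y * x`. -/
def skew {R : Type*} [Ring R] [Algebra ℚ R] (σ : RingInvo R) : LieSubalgebra ℚ R where
  carrier := {x | app σ x = -x}
  add_mem' {x y} hx hy := by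
    simp only [Set.mem_ofPred_eq] at *
    rw [app_add, hx, hy]; abel
  zero_mem' := by simp [app_zero]
  smul_mem' c x hx := by
    simp only [Set.mem_ofPred_eq] at *
    have h := map_rat_smul (AddMonoidHom.mk' (app σ) (app_add σ)) c x
    simp only [AddMonoidHom.mk'_apply] at h
    rw [h, hx, smul_neg]
  lie_mem' {x y} hx hy := by
    change app σ x = -x at hx
    change app σ y = -y at hy
    change app σ ⁅x, y⁆ = -⁅x, y⁆
    rw [Ring.lie_def, sub_eq_add_neg, app_add, app_neg, app_mul, app_mul, hx, hy]
    noncomm_ring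

/-- The subring `F = Z(R) ∩ {x | σ x = x}` of central symmetric elements. -/
def symCenter {R : Type*} [Ring R] (σ : RingInvo R) : Subring R where
  carrier := {x | x ∈ Subring.center R ∧ app σ x = x}
  mul_mem' {x y} hx hy := by
    refine ⟨mul_mem hx.1 hy.1, ?_⟩
    rw [app_mul, hx.2, hy.2]
    exact Subring.mem_center_iff.1 hx.1 y
  one_mem' := ⟨one_mem _, app_one σ⟩
  add_mem' {x y} hx hy := ⟨add_mem hx.1 hy.1, by rw [app_add, hx.2, hy.2]⟩
  zero_mem' := ⟨zero_mem _, app_zero σ⟩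
  neg_mem' {x} hx := ⟨neg_mem hx.1, by rw [app_neg, hx.2]⟩

/-- The skew-symmetric elements as a module over `F = Z(R) ∩ {x | σ x = x}`. -/
def skewModule {R : Type*} [Ring R] (σ : RingInvo R) : Submodule (symCenter σ) R where
  carrier := {x | app σ x = -x}
  add_mem' {x y} hx hy := by
    simp only [Set.mem_ofPred_eq] at *
    rw [app_add, hx, hy]; abel
  zero_mem' := by simp [app_zero]
  smul_mem' c x hx := by
    simp only [Set.mem_ofPred_eq] at *
    have hc : app σ (c : R) = c := c.2.2
    rw [Subring.smul_def, smul_eq_mul, app_mul, hx, hc, neg_mul,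
      Subring.mem_center_iff.1 c.2.1 x]

/-- The dimension over `F = Z(R) ∩ {x | σ x = x}` of the space of skew-symmetric elements. -/
noncomputable def skewDim {R : Type*} [Ring R] (σ : RingInvo R) : ℕ :=
  Module.finrank (symCenter σ) (skewModule σ)

/-- The dimension of `R` over its centre. -/
noncomputable def centerDim (R : Type*) [Ring R] : ℕ :=
  Module.finrank (Subring.center R) R

/-- `σ` is of the first kind: it fixes the centre elementwise, that is, `F = Z(R)`. -/
def IsFirstKind {R : Type*} [Ring R] (σ : RingInvo R) : Prop :=
  ∀ z ∈ Subring.center R, app σ z = z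

/-- Unitary type: `σ` is of the second kind, that is, not the identity on the centre. -/
def IsUnitaryType {R : Type*} [Ring R] (σ : RingInvo R) : Prop :=
  ¬ IsFirstKind σ

/-- Let `R` be central simple over its centre `Z`, and let `ε = ±1`. The involution `σ` is of the
first kind and, for some splitting field `L` of `R` and some isomorphism
`φ : L ⊗[Z] R ≃ End_L(W)`, the extended involution `id ⊗ σ` becomes the adjoint involution of a
nonsingular bilinear form `b` on `W` with `b y x = ε b x y`. (Both `id ⊗ σ` and the adjoint
involution are `L`-linear, so it is enough to compare them on the elements `1 ⊗ a`.) -/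
def IsAdjointOfSign {R : Type u} [Ring R] (σ : RingInvo R) (ε : ℤ) : Prop :=
  IsFirstKind σ ∧
  ∃ (L : Type u) (_ : Field L) (_ : Algebra (Subring.center R) L)
    (W : Type u) (_ : AddCommGroup W) (_ : Module L W) (_ : Module.Finite L W)
    (φ : (L ⊗[Subring.center R] R) ≃ₐ[L] Module.End L W) (b : LinearMap.BilinForm L W),
    b.Nondegenerate ∧ (∀ x y, b y x = ε • b x y) ∧
    ∀ (a : R) (x y : W), b x (φ (1 ⊗ₜ a) y) = b (φ (1 ⊗ₜ app σ a) x) y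

/-- Orthogonal type: over a splitting field, `σ` is adjoint to a symmetric bilinear form. -/
def IsOrthogonalType {R : Type u} [Ring R] (σ : RingInvo R) : Prop :=
  IsAdjointOfSign σ 1

/-- Symplectic type: over a splitting field, `σ` is adjoint to a skew-symmetric bilinear form. -/
def IsSymplecticType {R : Type u} [Ring R] (σ : RingInvo R) : Prop :=
  IsAdjointOfSign σ (-1)

end Involution

section Product

/-! ### Involutions of a product of rings -/

variable {ι : Type*} {A : ι → Type*} [∀ i, Ring (A i)]

/-- The factor `A i`, as a subset (two-sided ideal) of the product `∏ i, A i`. -/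
def factor (A : ι → Type*) [∀ i, Ring (A i)] (i : ι) : Set (∀ i, A i) :=
  {x | ∀ j, j ≠ i → x j = 0}

/-- `s (A i) = A j`. For `i = j` the factor `A i` is `s`-stable; for `i ≠ j` the factors
`A i` and `A j` are exchanged by `s`. -/
def Maps (s : RingInvo (∀ i, A i)) (i j : ι) : Prop :=
  app s '' factor A i = factor A j

theorem Maps.mem {s : RingInvo (∀ i, A i)} {i j : ι} (h : Maps s i j) {x : ∀ i, A i}
    (hx : x ∈ factor A i) : app s x ∈ factor A j :=
  h ▸ Set.mem_image_of_mem _ hx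

theorem Maps.symm {s : RingInvo (∀ i, A i)} {i j : ι} (h : Maps s i j) : Maps s j i := by
  unfold Maps at *
  rw [← h, ← Set.image_comp]
  convert Set.image_id _
  exact funext fun x => app_app s x

open Classical in
theorem single_mem_factor (i : ι) (a : A i) : Pi.single i a ∈ factor A i :=
  fun _ hj => Pi.single_eq_of_ne hj a

open Classical in
theorem single_apply_of_mem_factor {i : ι} {x : ∀ i, A i} (hx : x ∈ factor A i) :
    Pi.single i (x i) = x := by
  funext j
  by_cases hj : j = i
  · subst hj; simp
  · rw [Pi.single_eq_of_ne hj, hx j hj]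

open Classical in
/-- The restriction of `s` to an `s`-stable factor `A i`. -/
noncomputable def blockInvo (s : RingInvo (∀ i, A i)) {i : ι} (h : Maps s i i) : RingInvo (A i) :=
  ofFun (fun a => app s (Pi.single i a) i)
    (fun a b => by simp [Pi.single_add, app_add])
    (fun a b => by simp [Pi.single_mul, app_mul])
    (fun a => by
      rw [single_apply_of_mem_factor (h.mem (single_mem_factor i a)), app_app]; simp)

open Classical in
/-- The restriction of `s` to the product `A i × A j` of two distinct factors exchanged by `s`. -/
noncomputable def pairInvo (s : RingInvo (∀ i, A i)) {i j : ι} (h : Maps s i j) :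
    RingInvo (A i × A j) :=
  ofFun (fun a => (app s (Pi.single j a.2) i, app s (Pi.single i a.1) j))
    (fun a b => by ext <;> simp [Pi.single_add, app_add])
    (fun a b => by ext <;> simp [Pi.single_mul, app_mul])
    (fun a => by
      ext
      · simp only
        rw [single_apply_of_mem_factor (h.mem (single_mem_factor i a.1)), app_app]; simp
      · simp only
        rw [single_apply_of_mem_factor (h.symm.mem (single_mem_factor j a.2)), app_app]; simp)

/-- Indices of the stable factors on which `s` is of orthogonal type. -/
def orthogonalSet {A : ι → Type u} [∀ i, Ring (A i)] (s : RingInvo (∀ i, A i)) : Set ι :=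
  {i | ∃ h : Maps s i i, IsOrthogonalType (blockInvo s h)}

/-- Indices of the stable factors on which `s` is of symplectic type. -/
def symplecticSet {A : ι → Type u} [∀ i, Ring (A i)] (s : RingInvo (∀ i, A i)) : Set ι :=
  {i | ∃ h : Maps s i i, IsSymplecticType (blockInvo s h)}

/-- Indices of the stable factors on which `s` is of unitary type. -/
def unitarySet (s : RingInvo (∀ i, A i)) : Set ι :=
  {i | ∃ h : Maps s i i, IsUnitaryType (blockInvo s h)}

/-- The pairs of distinct factors exchanged by `s`, each written as `(i, j)` with `i ∈ T`. -/
def exchangedPairs (s : RingInvo (∀ i, A i)) (T : Set ι) : Set (ι × ι) :=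
  {p | p.1 ∈ T ∧ p.1 ≠ p.2 ∧ Maps s p.1 p.2}

/-- `T` contains exactly one index of every pair of distinct factors exchanged by `s`. -/
def SelectsOne (s : RingInvo (∀ i, A i)) (T : Set ι) : Prop :=
  ∀ i j, i ≠ j → Maps s i j → Xor (i ∈ T) (j ∈ T)

end Product

section Modules

/-- The division algebra of `R`-linear endomorphisms of a simple `R`-module `V`. (Acting on the
left of `V`, it is the opposite of the division algebra `D` acting on the right of `V`.) -/
abbrev D (R V : Type*) [Ring R] [AddCommGroup V] [Module R V] : Type _ := Module.End R V

/-- The algebra `End_D(V)` attached to a simple `R`-module `V`. -/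
abbrev EndD (R V : Type*) [Ring R] [AddCommGroup V] [Module R V] : Type _ :=
  Module.End (D R V) V

/-- `V` lists the simple `R`-modules, each isomorphism class exactly once. -/
structure IsCompleteListOfSimples (R : Type u) [Ring R] {ι : Type*} (V : ι → Type u)
    [∀ i, AddCommGroup (V i)] [∀ i, Module R (V i)] : Prop where
  simple : ∀ i, IsSimpleModule R (V i)
  eq_of_iso : ∀ i j, Nonempty (V i ≃ₗ[R] V j) → i = j
  complete : ∀ (W : Type u) [AddCommGroup W] [Module R W], IsSimpleModule R W →
    ∃ i, Nonempty (W ≃ₗ[R] V i)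

end Modules

end SkewGroupAlgebra

/-! By Maschke's theorem ℚG is semisimple. The action on the simple modules is faithful, and by
Schur's lemma and Jacobson density it fills the product of the blocks End_D(V)
(`IsCompleteListOfSimples.algEquiv`). An involution sends the identity of a block to a central
idempotent, whose components in simple rings are 0 or 1; hence it permutes the blocks
(`existsUnique_maps`).

Let a stable block have degree n. If σ fixes Z, extending scalars to an algebraic closure turns the
block into End(W) (`isSimpleRing_baseChange`, `exists_split`), and Skolem–Noether yields a form of
sign ε = ±1 to which σ is adjoint (`exists_bilinForm_of_antiInvolution`). In suitable coordinates σ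
is ε times matrix transposition, so its trace is εn. The trace survives scalar extension, so the
(-1)-eigenspace has dimension (n² - εn)/2. If σ moves Z, multiplication by a nonzero skew central
element exchanges symmetric and skew elements, so the skew part is half of a space of F-dimension
2n². These dimensions separate the types, except that n(n+1)/2 = n² when n = 1, which the parity
condition excludes.

On an exchanged pair the skew elements form the graph of -σ, a copy of the first block. Each block
occurs in exactly one summand of the Lie algebra decomposition (`exists_component`), which makes the
projections bijective. -/

namespace SkewGroupAlgebra

/-! ### Anti-involutions of End(W) and bilinear forms -/

section Adjoint

variable {K W : Type*} [Field K] [AddCommGroup W] [Module K W]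

/-- An endomorphism commuting with all endomorphisms is a scalar. -/
theorem exists_smul_of_commute_end (c : Module.End K W) (hc : ∀ f : Module.End K W, f * c = c * f) :
    ∃ k : K, ∀ x, c x = k • x := by
  have h : c ∈ Subalgebra.center K (Module.End K W) := Subalgebra.mem_center_iff.2 hc
  obtain ⟨k, rfl⟩ := (Algebra.IsCentral.mem_center_iff K).1 h
  exact ⟨k, fun x => by simp⟩

variable [FiniteDimensional K W]

/-- A linear anti-involution of `End W` is adjoint to a nondegenerate bilinear form that is symmetric
or skew-symmetric. -/
theorem exists_bilinForm_of_antiInvolution [Nontrivial W]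
    (τ : Module.End K W →ₗ[K] Module.End K W)
    (hmul : ∀ f g, τ (f * g) = τ g * τ f) (hone : τ 1 = 1) (hinv : ∀ f, τ (τ f) = f) :
    ∃ (b : LinearMap.BilinForm K W) (ε : ℤ), (ε = 1 ∨ ε = -1) ∧ b.Nondegenerate ∧
      (∀ x y, b y x = ε • b x y) ∧ ∀ f x y, b x (f y) = b (τ f x) y := by
  -- Both τ and dualization reverse products, so their composite is an algebra homomorphism End(W) →
  -- End(W*).
  let F : Module.End K W →ₐ[K] Module.End K (Module.Dual K W) :=
    AlgHom.ofLinearMap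
      { toFun := fun f => (τ f).dualMap
        map_add' := fun f g => by ext; simp
        map_smul' := fun c f => by ext; simp }
      (by ext; simp [hone]) (fun f g => by ext; simp [hmul])
  have hFinj : Function.Injective F := by
    intro f g h
    have h' : (τ f).dualMap = (τ g).dualMap := h
    have h2 : τ f = τ g := by
      ext x
      refine (Module.forall_dual_apply_eq_zero_iff K _).1 (fun φ => ?_) |> sub_eq_zero.1
      have := LinearMap.congr_fun (LinearMap.congr_fun h' φ) x
      simp only [LinearMap.dualMap_apply] at this
      simp [this]
    rw [← hinv f, h2, hinv]
  have hF : Function.Bijective F := by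
    refine ⟨hFinj, ?_⟩
    have hdim : Module.finrank K (Module.End K W) =
        Module.finrank K (Module.End K (Module.Dual K W)) := by
      simp [Module.finrank_linearMap, Subspace.dual_finrank_eq]
    exact (LinearMap.injective_iff_surjective_of_finrank_eq_finrank (V := Module.End K W)
      (V₂ := Module.End K (Module.Dual K W)) hdim (f := F.toLinearMap)).1 hFinj
  -- Skolem–Noether: `F` is conjugation by a linear isomorphism T : W → W*, and T is the desired
  -- bilinear form.
  obtain ⟨T, hT⟩ := (AlgEquiv.ofBijective F hF).eq_linearEquivConjAlgEquiv
  have key : ∀ (f : Module.End K W) (x y : W), T (f x) y = T x (τ f y) := by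
    intro f x y
    have h1 : F f (T x) = T (f x) := by
      have := congr($hT f (T x))
      simpa using! this
    rw [← h1]; rfl
  let b : LinearMap.BilinForm K W := T.toLinearMap
  have hb : b.Nondegenerate := by
    refine (LinearMap.BilinForm.nondegenerate_iff_ker_eq_bot).2 ?_
    exact T.ker
  have hb' : b.flip.Nondegenerate := by
    exact (LinearMap.BilinForm.nondegenerate_flip_iff).2 hb
  let T' : W ≃ₗ[K] Module.Dual K W :=
    LinearMap.BilinForm.toDual b.flip hb'
  have hT' : ∀ x y, T' x y = T y x := fun x y => rfl
  have key' : ∀ (f : Module.End K W) (x y : W), T' (f x) y = T' x (τ f y) := by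
    intro f x y
    rw [hT', hT', key, hinv]
  -- `c` compares the form with its transpose. Both have the same adjoint involution, so `c`
  -- commutes with every endomorphism and is a scalar k; transposing twice then gives k² = 1.
  let c : Module.End K W := (T'.trans T.symm).toLinearMap
  have hTc : ∀ x, T (c x) = T' x := fun x => by simp [c]
  obtain ⟨k, hk⟩ := exists_smul_of_commute_end c (fun f => by
    ext x
    apply T.injective
    ext y
    simp only [Module.End.mul_apply]
    rw [hTc, key, hTc, key'])
  have hsym : ∀ x y, T y x = k * T x y := by
    intro x y
    rw [← hT', ← hTc, hk]; simp
  obtain ⟨x, hx⟩ := exists_ne (0 : W)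
  obtain ⟨y, hy⟩ : ∃ y, T x y ≠ 0 := by
    by_contra! h
    exact hx (T.injective (by ext y; simp [h y]))
  have hkk : k * k = 1 := by
    have h1 := hsym x y
    have h2 := hsym y x
    rw [h1] at h2
    have : (k * k - 1) * T x y = 0 := by linear_combination -h2
    rcases mul_eq_zero.1 this with h | h
    · linear_combination h
    · exact absurd h hy
  have hadj : ∀ (f : Module.End K W) x y, b x (f y) = b (τ f x) y := by
    intro f x y
    change T x (f y) = T (τ f x) y
    rw [key, hinv]
  rcases mul_self_eq_one_iff.1 hkk with h | h
  · exact ⟨b, 1, Or.inl rfl, hb, fun x y => by simpa [h] using! hsym x y, hadj⟩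
  · exact ⟨b, -1, Or.inr rfl, hb, fun x y => by simpa [h] using! hsym x y, hadj⟩

/-- The matrix transpose has trace equal to the size of the matrices. -/
theorem trace_transpose (n : ℕ) :
    LinearMap.trace K (Matrix (Fin n) (Fin n) K)
      (Matrix.transposeLinearEquiv (Fin n) (Fin n) K K).toLinearMap = n := by
  classical
  rw [LinearMap.trace_eq_matrix_trace K (Matrix.stdBasis K (Fin n) (Fin n)), Matrix.trace,
    Fintype.sum_prod_type]
  have : ∀ i j : Fin n, (LinearMap.toMatrix (Matrix.stdBasis K (Fin n) (Fin n))
      (Matrix.stdBasis K (Fin n) (Fin n))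
      (Matrix.transposeLinearEquiv (Fin n) (Fin n) K K).toLinearMap).diag (i, j) =
      if i = j then 1 else 0 := by
    intro i j
    rw [Matrix.diag_apply, LinearMap.toMatrix_apply, Matrix.stdBasis_eq_single]
    by_cases h : i = j
    · subst h; simp [Matrix.stdBasis]
    · simp [Matrix.stdBasis, h]
  simp_rw [this]
  simp

/-- The trace of an adjoint involution of `End W` is `ε * dim W`. -/
theorem trace_of_isAdjoint (τ : Module.End K W →ₗ[K] Module.End K W)
    (b : LinearMap.BilinForm K W) (ε : ℤ) (hb : b.Nondegenerate)
    (hsym : ∀ x y, b y x = ε • b x y) (hadj : ∀ f x y, b x (f y) = b (τ f x) y) :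
    LinearMap.trace K _ τ = ε * Module.finrank K W := by
  classical
  let n := Module.finrank K W
  let v := Module.finBasis K W
  let D : W ≃ₗ[K] Module.Dual K W :=
    LinearMap.BilinForm.toDual b.flip (LinearMap.BilinForm.nondegenerate_flip_iff.2 hb)
  let E : Module.End K W ≃ₗ[K] Matrix (Fin n) (Fin n) K :=
    (LinearEquiv.congrRight (M₂ := W) D).trans (LinearMap.BilinForm.toMatrix v)
  have hE : ∀ f i j, E f i j = b (v j) (f (v i)) := by
    intro f i j
    simp [E, D]
    rfl
  -- Moving f across the form costs a swap of arguments, hence the sign ε; the row and column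
  -- indices are exchanged.
  have hconj : E.conj τ = (ε : K) •
      (Matrix.transposeLinearEquiv (Fin n) (Fin n) K K).toLinearMap := by
    ext1 M
    obtain ⟨f, rfl⟩ := E.surjective M
    ext i j
    simp only [LinearEquiv.conj_apply, LinearMap.comp_apply, LinearEquiv.coe_coe,
      LinearEquiv.symm_apply_apply, LinearMap.smul_apply, Matrix.transposeLinearEquiv_apply,
      Matrix.smul_apply, hE, smul_eq_mul]
    change _ = _ * E f j i
    rw [hE, hsym (τ f (v i)), ← hadj]
    simp
  rw [← LinearMap.trace_conj' τ E, hconj, map_smul, trace_transpose]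
  simp [n]

/-- A nondegenerate skew-symmetric form lives on an even dimensional space. -/
theorem even_finrank_of_skew [CharZero K] (b : LinearMap.BilinForm K W) (hb : b.Nondegenerate)
    (hsym : ∀ x y, b y x = (-1 : ℤ) • b x y) : Even (Module.finrank K W) := by
  classical
  let v := Module.finBasis K W
  let M := LinearMap.BilinForm.toMatrix v b
  have hM : M.det ≠ 0 := (LinearMap.BilinForm.nondegenerate_iff_det_ne_zero v).1 hb
  have hT : M.transpose = -M := by
    ext i j
    simp [M, hsym (v i) (v j)]
  by_contra hodd
  have h := Matrix.det_transpose M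
  rw [hT, Matrix.det_neg, Fintype.card_fin, (Nat.not_even_iff_odd.1 hodd).neg_one_pow] at h
  apply hM
  have : (2 : K) * M.det = 0 := by linear_combination -h
  simpa using this

end Adjoint

/-! ### Central simple algebras, scalar extension and eigenspace dimensions -/

section CentralSimple

variable {Z A : Type*} [Field Z] [Ring A] [Algebra Z A]

/-- Over its enveloping algebra, a simple ring is a simple module. -/
theorem isSimpleModule_mulLeftRight_range [IsSimpleRing A] :
    IsSimpleModule (AlgHom.mulLeftRight Z A).range A := by
  have hsmul : ∀ (N : Submodule (AlgHom.mulLeftRight Z A).range A) (a x c : A), x ∈ N →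
      a * x * c ∈ N := by
    intro N a x c hx
    have := N.smul_mem ⟨_, AlgHom.mem_range_self (AlgHom.mulLeftRight Z A)
      (a ⊗ₜ MulOpposite.op c)⟩ hx
    rwa [Subalgebra.smul_def, Module.End.smul_def, AlgHom.mulLeftRight_apply] at this
  refine @IsSimpleModule.mk _ _ _ _ _ (@IsSimpleOrder.mk _ _ _ _ fun N => ?_)
  by_cases hN : N = ⊥
  · exact Or.inl hN
  right
  obtain ⟨x, hx, hx0⟩ := N.exists_mem_ne_zero_of_ne_bot hN
  -- A submodule over the enveloping algebra is the same thing as a two-sided ideal.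
  let I : TwoSidedIdeal A := TwoSidedIdeal.mk' N N.zero_mem N.add_mem
    (fun {x} hx => by simpa using hsmul N (-1) x 1 hx)
    (fun {a x} hx => by simpa using hsmul N a x 1 hx)
    (fun {x a} hx => by simpa using hsmul N 1 x a hx)
  have h1 : (1 : A) ∈ I := IsSimpleRing.one_mem_of_ne_zero_mem I hx0
    ((TwoSidedIdeal.mem_mk' _ _ _ _ _ _ _).2 hx)
  have h1' : (1 : A) ∈ N := (TwoSidedIdeal.mem_mk' _ _ _ _ _ _ _).1 h1
  rw [eq_top_iff]
  intro a _
  simpa using hsmul N a 1 1 h1'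

/-- Every linear endomorphism of a finite dimensional central simple algebra is a sum of maps
`x ↦ a * x * c`. -/
theorem mulLeftRight_surjective [IsSimpleRing A] [Algebra.IsCentral Z A] [FiniteDimensional Z A] :
    Function.Surjective (AlgHom.mulLeftRight Z A) := by
  classical
  intro f
  let S := (AlgHom.mulLeftRight Z A).range
  have : IsSimpleModule S A := isSimpleModule_mulLeftRight_range
  have hS : ∀ (d : Module.End S A) (a x c : A), d (a * x * c) = a * d x * c := by
    intro d a x c
    have := d.map_smul (⟨_, AlgHom.mem_range_self (AlgHom.mulLeftRight Z A)
      (a ⊗ₜ MulOpposite.op c)⟩ : S) x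
    simpa [Subalgebra.smul_def] using this
  -- The commutant of the enveloping algebra is Z: such a d is determined by d 1, which is central.
  -- So every Z-linear f lies in the double commutant, and density on a finite basis applies.
  have hd : ∀ d : Module.End S A, ∃ z : Z, ∀ x, d x = z • x := by
    intro d
    have h : d 1 ∈ Subalgebra.center Z A := Subalgebra.mem_center_iff.2 fun a => by
      have h1 := hS d a 1 1
      have h2 := hS d 1 1 a
      simp only [mul_one, one_mul] at h1 h2
      rw [← h1, h2]
    obtain ⟨z, hz⟩ := (Algebra.IsCentral.mem_center_iff Z).1 h
    refine ⟨z, fun x => ?_⟩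
    have h1 := hS d x 1 1
    simp only [mul_one] at h1
    rw [h1, hz, Algebra.smul_def, Algebra.commutes]
  let f' : Module.End (Module.End S A) A :=
    { toFun := f
      map_add' := f.map_add
      map_smul' := fun d x => by
        obtain ⟨z, hz⟩ := hd d
        simp [hz] }
  let b := Module.finBasis Z A
  obtain ⟨⟨r, t, rfl⟩, hr⟩ := jacobson_density (R := S) f' (Finset.univ.image b)
  refine ⟨t, b.ext fun i => ?_⟩
  exact (hr (b i) (by simp)).symm

variable (L : Type*) [Field L] [Algebra Z L]

/-- A scalar extension of a finite dimensional central simple algebra is simple. -/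
theorem isSimpleRing_baseChange [IsSimpleRing A] [Algebra.IsCentral Z A] [FiniteDimensional Z A] :
    IsSimpleRing (L ⊗[Z] A) := by
  -- Since all Z-endomorphisms of A are sums of maps x ↦ a x c, two-sided ideals of the extension
  -- are stable under their base changes.
  have hmem : ∀ (I : TwoSidedIdeal (L ⊗[Z] A)) (x : L ⊗[Z] A), x ∈ I → ∀ f : A →ₗ[Z] A,
      f.baseChange L x ∈ I := by
    intro I x hx f
    obtain ⟨t, rfl⟩ := mulLeftRight_surjective f
    induction t using TensorProduct.induction_on with
    | zero => simp
    | add s t hs ht =>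
      rw [map_add, LinearMap.baseChange_add, LinearMap.add_apply]
      exact I.add_mem hs ht
    | tmul a c =>
      have : ∀ y : L ⊗[Z] A, (AlgHom.mulLeftRight Z A (a ⊗ₜ c)).baseChange L y =
          (1 ⊗ₜ a) * y * (1 ⊗ₜ c.unop) := by
        intro y
        induction y using TensorProduct.induction_on with
        | zero => simp
        | add y z hy hz => rw [map_add, hy, hz, mul_add, add_mul]
        | tmul l y => simp
      rw [this]
      exact I.mul_mem_right _ _ (I.mul_mem_left _ _ hx)
  refine ⟨@IsSimpleOrder.mk _ _ _ _ fun I => ?_⟩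
  by_cases hI : I = ⊥
  · exact Or.inl hI
  right
  obtain ⟨x, hx, hx0⟩ : ∃ x ∈ I, x ≠ 0 := by
    by_contra! h
    exact hI (le_antisymm (fun y hy => by simp [h y hy]) bot_le)
  let b := Module.finBasis Z A
  let B := Algebra.TensorProduct.basis L b
  obtain ⟨k, hk⟩ : ∃ k, B.repr x k ≠ 0 := by
    by_contra! h
    exact hx0 (B.repr.map_eq_zero_iff.1 (Finsupp.ext h))
  -- A rank-one endomorphism isolates one nonzero coordinate of x, placing l ⊗ 1 with l ≠ 0 in the
  -- ideal.
  have hx1 := hmem I x hx ((b.coord k).smulRight 1)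
  have hval : ∀ y, ((b.coord k).smulRight (1 : A)).baseChange L y = B.repr y k ⊗ₜ 1 := by
    intro y
    induction y using TensorProduct.induction_on with
    | zero => simp
    | add y z hy hz => rw [map_add, hy, hz, map_add, Finsupp.add_apply, TensorProduct.add_tmul]
    | tmul l y =>
      rw [LinearMap.baseChange_tmul, LinearMap.smulRight_apply, ← TensorProduct.smul_tmul]
      simp [B, Algebra.smul_def, mul_comm]
  rw [hval] at hx1
  have h1 : (1 : L ⊗[Z] A) ∈ I := by
    have := I.mul_mem_left ((B.repr x k)⁻¹ ⊗ₜ 1) _ hx1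
    rwa [Algebra.TensorProduct.tmul_mul_tmul, inv_mul_cancel₀ hk, one_mul] at this
  rw [eq_top_iff]
  intro y _
  simpa using I.mul_mem_left y _ h1

/-- A finite dimensional central simple algebra is split by any algebraically closed field. -/
theorem exists_split [IsSimpleRing A] [Algebra.IsCentral Z A] [FiniteDimensional Z A]
    [IsAlgClosed L] : ∃ n : ℕ, 0 < n ∧ Nonempty ((L ⊗[Z] A) ≃ₐ[L] Module.End L (Fin n → L)) := by
  have := isSimpleRing_baseChange (Z := Z) (A := A) L
  obtain ⟨n, hn, ⟨e⟩⟩ := IsSimpleRing.exists_algEquiv_matrix_of_isAlgClosed L (L ⊗[Z] A)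
  exact ⟨n, Nat.pos_of_ne_zero hn.ne, ⟨e.trans Matrix.toLinAlgEquiv'⟩⟩

variable {L}

theorem finrank_eq_sq_of_split {W : Type*} [AddCommGroup W] [Module L W] [FiniteDimensional L W]
    (φ : (L ⊗[Z] A) ≃ₐ[L] Module.End L W) : Module.finrank Z A = Module.finrank L W ^ 2 := by
  rw [← Module.finrank_baseChange (R := L) (S := Z), φ.toLinearEquiv.finrank_eq,
    Module.finrank_linearMap, sq]

/-- The fixed-point formula for the dimension of the `-1`-eigenspace of an involutive map. -/
theorem two_mul_finrank_ker_add_one [CharZero Z] {M : Type*} [AddCommGroup M] [Module Z M]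
    [FiniteDimensional Z M] (s : M →ₗ[Z] M)
    (hs : ∀ x, s (s x) = x) :
    (2 * Module.finrank Z (LinearMap.ker (s + 1 : Module.End Z M)) : Z) =
      Module.finrank Z M - LinearMap.trace Z M s := by
  -- (1 - s)/2 projects onto the (-1)-eigenspace, and the trace of a projection is its rank.
  let p : Module.End Z M := (2⁻¹ : Z) • (1 - s)
  have hp : LinearMap.IsProj (LinearMap.ker (s + 1 : Module.End Z M)) p := by
    refine ⟨fun x => ?_, fun x hx => ?_⟩
    · simp [p, hs]
    · have hx' : s x = -x := by
        rw [LinearMap.mem_ker] at hx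
        exact eq_neg_of_add_eq_zero_left (by simpa using hx)
      simp only [p, LinearMap.smul_apply, LinearMap.sub_apply, Module.End.one_apply, hx',
        sub_neg_eq_add, ← two_smul Z x, smul_smul]
      simp
  have h := hp.trace
  rw [← h]
  simp [p]

/-- The dimension of the skew elements of an involution that is, after scalar extension, adjoint to
a form of sign `ε`. -/
theorem two_mul_finrank_skew_of_adjoint [CharZero Z] [FiniteDimensional Z A] (s : A →ₗ[Z] A)
    (hs : ∀ x, s (s x) = x)
    {W : Type*} [AddCommGroup W] [Module L W] [FiniteDimensional L W]
    (φ : (L ⊗[Z] A) ≃ₐ[L] Module.End L W) (b : LinearMap.BilinForm L W) (ε : ℤ)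
    (hb : b.Nondegenerate) (hsym : ∀ x y, b y x = ε • b x y)
    (hadj : ∀ (a : A) (x y : W), b x (φ (1 ⊗ₜ a) y) = b (φ (1 ⊗ₜ s a) x) y) :
    (2 * Module.finrank Z (LinearMap.ker (s + 1 : Module.End Z A)) : ℤ) =
      (Module.finrank L W : ℤ) ^ 2 - ε * Module.finrank L W := by
  have : CharZero L := charZero_of_injective_algebraMap (algebraMap Z L).injective
  have hadj' : ∀ (t : L ⊗[Z] A) x y, b x (φ t y) = b (φ (s.baseChange L t) x) y := by
    intro t x y
    induction t using TensorProduct.induction_on with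
    | zero => simp
    | add t u ht hu => simp only [map_add, LinearMap.add_apply, ht, hu]
    | tmul l a =>
      have h1 : ∀ c : A, (l ⊗ₜ[Z] c : L ⊗[Z] A) = l • (1 ⊗ₜ c) := fun c => by
        simp [TensorProduct.smul_tmul']
      rw [LinearMap.baseChange_tmul, h1 a, h1 (s a), map_smul, map_smul]
      simp [hadj]
  let τ : Module.End L W →ₗ[L] Module.End L W := φ.toLinearEquiv.conj (s.baseChange L)
  have hτ := trace_of_isAdjoint τ b ε hb hsym (fun f x y => by
    obtain ⟨t, rfl⟩ := φ.surjective f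
    rw [hadj']
    simp [τ, LinearEquiv.conj_apply])
  rw [LinearMap.trace_conj', LinearMap.trace_baseChange] at hτ
  have h := congrArg (algebraMap Z L) (two_mul_finrank_ker_add_one s hs)
  rw [map_sub, hτ, finrank_eq_sq_of_split φ] at h
  have : (((2 * Module.finrank Z (LinearMap.ker (s + 1 : Module.End Z A)) : ℤ)) : L) =
      (((Module.finrank L W : ℤ) ^ 2 - ε * Module.finrank L W : ℤ) : L) := by
    push_cast
    simpa [map_ofNat (algebraMap Z L)] using h
  exact_mod_cast this

/-- An involution of the first kind becomes, over an algebraically closed field, adjoint to a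
symmetric or skew-symmetric form. -/
theorem exists_adjoint_form (s : A →ₗ[Z] A) (hs : ∀ x, s (s x) = x)
    (hmul : ∀ x y, s (x * y) = s y * s x) {W : Type*} [AddCommGroup W] [Module L W]
    [FiniteDimensional L W] [Nontrivial W] (φ : (L ⊗[Z] A) ≃ₐ[L] Module.End L W) :
    ∃ (b : LinearMap.BilinForm L W) (ε : ℤ), (ε = 1 ∨ ε = -1) ∧ b.Nondegenerate ∧
      (∀ x y, b y x = ε • b x y) ∧
      ∀ (a : A) (x y : W), b x (φ (1 ⊗ₜ a) y) = b (φ (1 ⊗ₜ s a) x) y := by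
  have hone : s 1 = 1 := by
    have h := hmul 1 (s 1)
    rw [one_mul, hs] at h
    simpa using h.symm
  have hmul' : ∀ t u, s.baseChange L (t * u) = s.baseChange L u * s.baseChange L t := by
    intro t u
    induction t using TensorProduct.induction_on with
    | zero => simp
    | add t t' ht ht' => simp only [add_mul, mul_add, map_add, ht, ht']
    | tmul l a =>
      induction u using TensorProduct.induction_on with
      | zero => simp
      | add u u' hu hu' => simp only [add_mul, mul_add, map_add, hu, hu']
      | tmul l' a' => simp [hmul, mul_comm]
  have hs' : ∀ t, s.baseChange L (s.baseChange L t) = t := by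
    intro t
    induction t using TensorProduct.induction_on with
    | zero => simp
    | add t t' ht ht' => simp only [map_add, ht, ht']
    | tmul l a => simp [hs]
  let τ : Module.End L W →ₗ[L] Module.End L W := φ.toLinearEquiv.conj (s.baseChange L)
  have hτ : ∀ t, τ (φ t) = φ (s.baseChange L t) := fun t => by simp [τ, LinearEquiv.conj_apply]
  obtain ⟨b, ε, hε, hb, hsym, hadj⟩ := exists_bilinForm_of_antiInvolution τ
    (fun f g => by
      obtain ⟨t, rfl⟩ := φ.surjective f
      obtain ⟨u, rfl⟩ := φ.surjective g
      rw [← map_mul, hτ, hτ, hτ, hmul', map_mul])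
    (by
      rw [← map_one φ, hτ, Algebra.TensorProduct.one_def, LinearMap.baseChange_tmul, hone])
    (fun f => by
      obtain ⟨t, rfl⟩ := φ.surjective f
      rw [hτ, hτ, hs'])
  refine ⟨b, ε, hε, hb, hsym, fun a x y => ?_⟩
  rw [hadj, hτ, LinearMap.baseChange_tmul]

end CentralSimple

/-! ### Changing the ring of scalars in dimensions -/

section SkewDim

/-- `skewDim` may be computed from any ring acting like the central symmetric elements. -/
theorem skewDim_eq_finrank {R S M : Type*} [Ring R] (σ : RingInvo R) [Ring S] [AddCommGroup M]
    [Module S M] (i : symCenter σ → S) (j : skewModule σ ≃+ M) (hi : Function.Bijective i)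
    (hc : ∀ r m, j (r • m) = i r • j m) : skewDim σ = Module.finrank S M := by
  have h := congrArg Cardinal.toNat (lift_rank_eq_of_equiv_equiv i j hi hc)
  simpa [skewDim, Module.finrank] using h

/-- `centerDim` is invariant under semilinear bijections. -/
theorem centerDim_eq_of_equiv {R S : Type*} [Ring R] [Ring S]
    (i : Subring.center R → Subring.center S) (j : R ≃+ S) (hi : Function.Bijective i)
    (hc : ∀ (r : Subring.center R) m, j (r * m) = i r * j m) : centerDim R = centerDim S := by
  have h := congrArg Cardinal.toNat (lift_rank_eq_of_equiv_equiv i j hi (fun r m => by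
    simpa [Subring.smul_def] using hc r m))
  simpa [centerDim, Module.finrank] using h

end SkewDim

/-! ### Involutions of a simple algebra -/

section SimpleInvolution

variable {R : Type u} [Ring R] [IsSimpleRing R] [Algebra ℚ R] [Module.Finite ℚ R]

/-- The centre of a simple ring, as a field. -/
noncomputable abbrev centerField (R : Type*) [Ring R] [IsSimpleRing R] : Field (Subring.center R) :=
  (IsSimpleRing.isField_center R).toField

theorem algebraMap_rat_mem_center (R : Type*) [Ring R] [Algebra ℚ R] (q : ℚ) :
    algebraMap ℚ R q ∈ Subring.center R :=
  Subring.mem_center_iff.2 fun r => (Algebra.commutes q r).symm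

/-- Additivity already forces ℚ-linearity. Hence F contains ℚ, and R is finite-dimensional over F.
-/
theorem app_algebraMap_rat {R : Type*} [Ring R] [Algebra ℚ R] (σ : RingInvo R) (q : ℚ) :
    app σ (algebraMap ℚ R q) = algebraMap ℚ R q := by
  have h := map_rat_smul (AddMonoidHom.mk' (app σ) (app_add σ)) q 1
  simp only [AddMonoidHom.mk'_apply] at h
  rw [Algebra.algebraMap_eq_smul_one, h, app_one]

/-- A finite dimensional rational algebra is finite over every subring containing `ℚ`. -/
theorem finite_subring {R : Type*} [Ring R] [Algebra ℚ R] [Module.Finite ℚ R] (S : Subring R)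
    (hS : ∀ q, algebraMap ℚ R q ∈ S) : Module.Finite S R := by
  obtain ⟨t, ht⟩ := Module.Finite.fg_top (R := ℚ) (M := R)
  refine ⟨t, ?_⟩
  rw [eq_top_iff]
  rintro x -
  have hx : x ∈ Submodule.span ℚ (t : Set R) := ht ▸ Submodule.mem_top
  induction hx using Submodule.span_induction with
  | mem x hx => exact Submodule.subset_span hx
  | zero => exact zero_mem _
  | add x y _ _ hx hy => exact add_mem hx hy
  | smul q x _ hx =>
    rw [Algebra.smul_def]
    exact Submodule.smul_mem _ (⟨algebraMap ℚ R q, hS q⟩ : S) hx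

theorem isCentral_center (R : Type*) [Ring R] : Algebra.IsCentral (Subring.center R) R := by
  constructor
  intro x hx
  rw [Subalgebra.mem_center_iff] at hx
  exact Algebra.mem_bot.2 ⟨⟨x, Subring.mem_center_iff.2 hx⟩, rfl⟩

theorem charZero_subring {R : Type*} [Ring R] [Nontrivial R] [Algebra ℚ R] (S : Subring R) :
    CharZero S := by
  have : CharZero R := algebraRat.charZero R
  exact ⟨fun a b h => by exact_mod_cast congrArg (Subtype.val) h⟩

variable (R) in
/-- The dimension of a simple algebra over its centre is a positive square. -/
theorem exists_centerDim_eq_sq : ∃ n : ℕ, 0 < n ∧ centerDim R = n ^ 2 := by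
  let := centerField R
  have := isCentral_center R
  have : Module.Finite (Subring.center R) R := finite_subring _ (algebraMap_rat_mem_center R)
  obtain ⟨n, hn, ⟨φ⟩⟩ := exists_split (Z := Subring.center R) (A := R)
    (AlgebraicClosure (Subring.center R))
  exact ⟨n, hn, by rw [centerDim, finrank_eq_sq_of_split φ]; simp⟩

/-- An involution of the first kind is linear over the centre. -/
def IsFirstKind.linearMap {R : Type*} [Ring R] {σ : RingInvo R} (h : IsFirstKind σ) :
    R →ₗ[Subring.center R] R where
  toFun := app σ
  map_add' := app_add σ
  map_smul' c x := by
    simp only [Subring.smul_def, smul_eq_mul, RingHom.id_apply]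
    rw [app_mul, h c c.2, Subring.mem_center_iff.1 c.2]

/-- Here F and Z have the same elements but are different types, so the scalars are moved along the
evident bijection. -/
theorem IsFirstKind.skewDim_eq {R : Type*} [Ring R] {σ : RingInvo R} (h : IsFirstKind σ) :
    skewDim σ = Module.finrank (Subring.center R)
      (LinearMap.ker (h.linearMap + 1 : Module.End (Subring.center R) R)) := by
  have hker : ∀ x, app σ x = -x ↔
      x ∈ LinearMap.ker (h.linearMap + 1 : Module.End (Subring.center R) R) := fun x => by
    rw [LinearMap.mem_ker]
    exact eq_neg_iff_add_eq_zero
  refine skewDim_eq_finrank σ (fun r => ⟨r, r.2.1⟩)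
    { toFun := fun x => ⟨x, (hker x).1 x.2⟩
      invFun := fun x => ⟨x, (hker x).2 x.2⟩
      left_inv := fun x => rfl
      right_inv := fun x => rfl
      map_add' := fun x y => rfl } ⟨fun x y hxy => ?_, fun z => ?_⟩ fun r m => rfl
  · exact Subtype.ext (congrArg (fun z : Subring.center R => (z : R)) hxy)
  · exact ⟨⟨z, z.2, h z z.2⟩, rfl⟩

/-- Any splitting field allowed by the definition will do: comparing dimensions gives dim W = n, and
the trace formula applies. -/
theorem IsAdjointOfSign.two_mul_skewDim {σ : RingInvo R} {ε : ℤ} (h : IsAdjointOfSign σ ε) {n : ℕ}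
    (hn : centerDim R = n ^ 2) : (2 * skewDim σ : ℤ) = (n : ℤ) ^ 2 - ε * n := by
  let := centerField R
  have : Module.Finite (Subring.center R) R := finite_subring _ (algebraMap_rat_mem_center R)
  have := charZero_subring (Subring.center R)
  obtain ⟨h1, L, _, _, W, _, _, _, φ, b, hb, hsym, hadj⟩ := h
  have h2 := two_mul_finrank_skew_of_adjoint h1.linearMap (fun x => app_app σ x) φ b ε hb hsym hadj
  have h3 : n = Module.finrank L W := by
    have := finrank_eq_sq_of_split φ
    rw [← centerDim, hn] at this
    exact Nat.pow_left_injective two_ne_zero this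
  rw [h1.skewDim_eq, h3]
  exact h2

theorem IsSymplecticType.even {σ : RingInvo R} (h : IsSymplecticType σ) {n : ℕ}
    (hn : centerDim R = n ^ 2) : Even n := by
  let := centerField R
  have : Module.Finite (Subring.center R) R := finite_subring _ (algebraMap_rat_mem_center R)
  have := charZero_subring (Subring.center R)
  obtain ⟨h1, L, _, _, W, _, _, _, φ, b, hb, hsym, hadj⟩ := h
  have h3 : n = Module.finrank L W := by
    have := finrank_eq_sq_of_split φ
    rw [← centerDim, hn] at this
    exact Nat.pow_left_injective two_ne_zero this
  have : CharZero L := charZero_of_injective_algebraMap (algebraMap (Subring.center R) L).injective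
  rw [h3]
  exact even_finrank_of_skew b hb hsym

/-- An involution of the first kind is of orthogonal or of symplectic type. -/
theorem IsFirstKind.orthogonal_or_symplectic {σ : RingInvo R} (h : IsFirstKind σ) :
    IsOrthogonalType σ ∨ IsSymplecticType σ := by
  let := centerField R
  have := isCentral_center R
  have : Module.Finite (Subring.center R) R := finite_subring _ (algebraMap_rat_mem_center R)
  obtain ⟨n, hn, ⟨φ⟩⟩ := exists_split (Z := Subring.center R) (A := R)
    (AlgebraicClosure (Subring.center R))
  have : NeZero n := ⟨hn.ne'⟩
  obtain ⟨b, ε, hε, hb, hsym, hadj⟩ := exists_adjoint_form h.linearMap (fun x => app_app σ x)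
    (app_mul σ) φ
  have key : IsAdjointOfSign σ ε :=
    ⟨h, AlgebraicClosure (Subring.center R), inferInstance, inferInstance,
      Fin n → AlgebraicClosure (Subring.center R), inferInstance, inferInstance, inferInstance,
      φ, b, hb, hsym, hadj⟩
  rcases hε with rfl | rfl
  · exact Or.inl key
  · exact Or.inr key

/-- An inverse taken in the centre is automatically symmetric, because σ y is also an inverse of x.
-/
theorem isField_symCenter {R : Type*} [Ring R] [IsSimpleRing R] (σ : RingInvo R) :
    IsField (symCenter σ) where
  exists_pair_ne := ⟨0, 1, zero_ne_one⟩
  mul_comm x y := Subtype.ext (Subring.mem_center_iff.1 y.2.1 x)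
  mul_inv_cancel := by
    rintro ⟨x, hx⟩ hx0
    obtain ⟨⟨y, hy⟩, hxy⟩ := (IsSimpleRing.isField_center R).mul_inv_cancel (a := ⟨x, hx.1⟩)
      (fun h => hx0 (Subtype.ext (congrArg (fun z : Subring.center R => (z : R)) h)))
    replace hxy : x * y = 1 := congrArg (fun z : Subring.center R => (z : R)) hxy
    refine ⟨⟨y, hy, ?_⟩, Subtype.ext hxy⟩
    have h := congrArg (app σ) hxy
    rw [app_mul, hx.2, app_one] at h
    calc app σ y = app σ y * (x * y) := by rw [hxy, mul_one]
      _ = y := by rw [← mul_assoc, h, one_mul]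

/-- If an involutive map anticommutes with a bijective one, then half of the space is skew. -/
theorem two_mul_finrank_ker_of_anticommute {Z M : Type*} [Field Z] [CharZero Z] [AddCommGroup M]
    [Module Z M] [FiniteDimensional Z M] (s : M →ₗ[Z] M) (hs : ∀ x, s (s x) = x) (m : M ≃ₗ[Z] M)
    (hm : ∀ x, s (m x) = -m (s x)) :
    2 * Module.finrank Z (LinearMap.ker (s + 1 : Module.End Z M)) = Module.finrank Z M := by
  -- Conjugate maps have equal traces, so s has trace zero.
  have h1 : m.conj s = -s := by
    ext x
    obtain ⟨y, rfl⟩ := m.surjective x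
    simp [LinearEquiv.conj_apply, hm]
  have h2 := LinearMap.trace_conj' s m
  rw [h1, map_neg] at h2
  have h3 : LinearMap.trace Z M s = 0 := by
    have : (2 : Z) * LinearMap.trace Z M s = 0 := by linear_combination -h2
    simpa using this
  have h4 := two_mul_finrank_ker_add_one s hs
  rw [h3, sub_zero] at h4
  exact_mod_cast h4

/-- An involution is linear over the central symmetric elements. -/
def symLinearMap {R : Type*} [Ring R] (σ : RingInvo R) : R →ₗ[symCenter σ] R where
  toFun := app σ
  map_add' := app_add σ
  map_smul' c x := by
    simp only [Subring.smul_def, smul_eq_mul, RingHom.id_apply]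
    rw [app_mul, c.2.2, Subring.mem_center_iff.1 c.2.1]

theorem app_mem_center {R : Type*} [Ring R] (σ : RingInvo R) {z : R}
    (hz : z ∈ Subring.center R) : app σ z ∈ Subring.center R := by
  refine Subring.mem_center_iff.2 fun x => ?_
  have h := congrArg (app σ) (Subring.mem_center_iff.1 hz (app σ x))
  rw [app_mul, app_mul, app_app] at h
  exact h.symm

instance symCenterModule {R : Type*} [Ring R] (σ : RingInvo R) :
    Module (symCenter σ) (Subring.center R) :=
  Module.compHom _ (Subring.inclusion (fun _ hx => hx.1 : symCenter σ ≤ Subring.center R))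

/-- The restriction of an involution to the centre. -/
def centerSymLinearMap {R : Type*} [Ring R] (σ : RingInvo R) :
    Subring.center R →ₗ[symCenter σ] Subring.center R where
  toFun z := ⟨app σ z, app_mem_center σ z.2⟩
  map_add' x y := Subtype.ext (app_add σ x y)
  map_smul' c x := Subtype.ext <| by
    change app σ ((c : R) * x) = c * app σ x
    rw [app_mul, c.2.2, Subring.mem_center_iff.1 c.2.1]

theorem skewDim_eq_finrank_ker {R : Type*} [Ring R] (σ : RingInvo R) :
    skewDim σ = Module.finrank (symCenter σ)
      (LinearMap.ker (symLinearMap σ + 1 : Module.End (symCenter σ) R)) := by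
  have : skewModule σ =
      LinearMap.ker (symLinearMap σ + 1 : Module.End (symCenter σ) R) := by
    ext x
    rw [LinearMap.mem_ker]
    exact eq_neg_iff_add_eq_zero
  rw [skewDim, this]

/-- An involution of the second kind has skew elements of dimension `n ^ 2`. -/
theorem IsUnitaryType.skewDim_eq {σ : RingInvo R} (h : IsUnitaryType σ) :
    skewDim σ = centerDim R := by
  let := centerField R
  let : Field (symCenter σ) := (isField_symCenter σ).toField
  have hF : ∀ q, algebraMap ℚ R q ∈ symCenter σ :=
    fun q => ⟨algebraMap_rat_mem_center R q, app_algebraMap_rat σ q⟩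
  have : Module.Finite (symCenter σ) R := finite_subring _ hF
  have := charZero_subring (symCenter σ)
  have : IsScalarTower (symCenter σ) (Subring.center R) R :=
    ⟨fun x y z => mul_assoc (x : R) (y : R) z⟩
  have : IsScalarTower (symCenter σ) (Subring.center R) (Subring.center R) :=
    ⟨fun x y z => Subtype.ext (mul_assoc (x : R) (y : R) (z : R))⟩
  let incl : Subring.center R →ₗ[symCenter σ] R :=
    { toFun := fun z => z
      map_add' := fun _ _ => rfl
      map_smul' := fun _ _ => rfl }
  have : Module.Finite (symCenter σ) (Subring.center R) :=
    Module.Finite.of_injective incl Subtype.val_injective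
  obtain ⟨w, hw, hσw⟩ : ∃ w ∈ Subring.center R, app σ w ≠ w := by
    by_contra! h'
    exact h h'
  -- A nonzero skew element of the centre; multiplication by it is invertible and anticommutes with
  -- σ.
  let z : Subring.center R := ⟨w - app σ w, sub_mem hw (app_mem_center σ hw)⟩
  have hz0 : z ≠ 0 := fun h0 => hσw
    (sub_eq_zero.1 (congrArg (fun z : Subring.center R => (z : R)) h0)).symm
  have hσz : app σ z = -z := by
    change app σ (w - app σ w) = -(w - app σ w)
    rw [sub_eq_add_neg, app_add, app_neg, app_app]
    abel
  let mR : R ≃ₗ[symCenter σ] R := (LinearEquiv.smulOfNeZero (Subring.center R) R z hz0).restrictScalars _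
  let mZ : Subring.center R ≃ₗ[symCenter σ] Subring.center R :=
    (LinearEquiv.smulOfNeZero (Subring.center R) (Subring.center R) z hz0).restrictScalars _
  have h1 := two_mul_finrank_ker_of_anticommute (symLinearMap σ) (app_app σ) mR (fun x => by
    change app σ ((z : R) * x) = -(z * app σ x)
    rw [app_mul, hσz, mul_neg, Subring.mem_center_iff.1 z.2])
  -- With -σ in place of σ, the eigenspace counted is the fixed field F itself, of dimension 1; this
  -- gives [Z : F] = 2.
  have h2 := two_mul_finrank_ker_of_anticommute (-centerSymLinearMap σ)
    (fun x => Subtype.ext (by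
      change -app σ (-app σ x) = x
      rw [app_neg, app_app, neg_neg])) mZ (fun x => Subtype.ext <| by
    change -app σ ((z : R) * x) = -(z * -app σ x)
    rw [app_mul, hσz, mul_neg, mul_neg, Subring.mem_center_iff.1 z.2])
  have h3 : Module.finrank (symCenter σ) (LinearMap.ker
      (-centerSymLinearMap σ + 1 : Module.End (symCenter σ) (Subring.center R))) = 1 := by
    have hker : ∀ x : Subring.center R, x ∈ LinearMap.ker
        (-centerSymLinearMap σ + 1 : Module.End (symCenter σ) (Subring.center R)) ↔
        app σ x = x := fun x => by
      rw [LinearMap.mem_ker, Subtype.ext_iff]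
      exact neg_add_eq_zero
    let e : symCenter σ ≃ₗ[symCenter σ] LinearMap.ker
        (-centerSymLinearMap σ + 1 : Module.End (symCenter σ) (Subring.center R)) :=
      { toFun := fun x => ⟨⟨x, x.2.1⟩, (hker _).2 x.2.2⟩
        invFun := fun x => ⟨x.1, x.1.2, (hker _).1 x.2⟩
        left_inv := fun _ => rfl
        right_inv := fun _ => rfl
        map_add' := fun _ _ => rfl
        map_smul' := fun _ _ => rfl }
    rw [← e.finrank_eq, Module.finrank_self]
  rw [h3] at h2
  rw [← skewDim_eq_finrank_ker] at h1
  -- Tower law: twice the skew dimension is dim_F R = 2 · dim_Z R.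
  have h4 := Module.finrank_mul_finrank (symCenter σ) (Subring.center R) R
  rw [← h2, ← h1] at h4
  rw [centerDim]
  omega

/-- The three types of involutions of a simple algebra of degree `n` are told apart by the dimension
of the skew elements. -/
theorem type_iff_skewDim (σ : RingInvo R) {n : ℕ} (hn0 : 0 < n) (hn : centerDim R = n ^ 2) :
    (IsOrthogonalType σ ∨ IsSymplecticType σ ∨ IsUnitaryType σ) ∧
      (IsOrthogonalType σ ↔ skewDim σ = n * (n - 1) / 2) ∧
      (IsSymplecticType σ ↔ skewDim σ = n * (n + 1) / 2 ∧ Even n) ∧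
      (IsUnitaryType σ ↔ skewDim σ = n ^ 2) := by
  -- Removes the truncated subtraction in n - 1.
  obtain ⟨m, rfl⟩ : ∃ m, n = m + 1 := ⟨n - 1, by omega⟩
  have e1 : 2 * ((m + 1) * (m + 1 - 1) / 2) = (m + 1) * m := by
    rw [Nat.add_sub_cancel]
    exact Nat.mul_div_cancel' (mul_comm m (m + 1) ▸ (Nat.even_mul_succ_self m).two_dvd)
  have e2 : 2 * ((m + 1) * (m + 1 + 1) / 2) = (m + 1) * (m + 2) :=
    Nat.mul_div_cancel' (Nat.even_mul_succ_self (m + 1)).two_dvd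
  have hO : IsOrthogonalType σ → 2 * skewDim σ = (m + 1) * m := fun h => by
    have := IsAdjointOfSign.two_mul_skewDim h hn
    push_cast at this
    zify
    linear_combination this
  have hS : IsSymplecticType σ → 2 * skewDim σ = (m + 1) * (m + 2) ∧ Even (m + 1) := fun h => by
    refine ⟨?_, h.even hn⟩
    have := IsAdjointOfSign.two_mul_skewDim h hn
    push_cast at this
    zify
    linear_combination this
  have hU : IsUnitaryType σ → skewDim σ = (m + 1) ^ 2 := fun h => by rw [h.skewDim_eq, hn]
  have hcases : IsOrthogonalType σ ∨ IsSymplecticType σ ∨ IsUnitaryType σ := by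
    by_cases h : IsFirstKind σ
    · rcases h.orthogonal_or_symplectic with h | h
      · exact Or.inl h
      · exact Or.inr (Or.inl h)
    · exact Or.inr (Or.inr h)
  refine ⟨hcases, ⟨fun h => ?_, fun h => ?_⟩, ⟨fun h => ?_, fun h => ?_⟩, ⟨hU, fun h => ?_⟩⟩
  · have := hO h
    omega
  · rcases hcases with h' | h' | h'
    · exact h'
    · have := (hS h').1
      rw [h, e1] at this
      nlinarith
    · have := hU h'
      have : (m + 1) * m = 2 * (m + 1) ^ 2 := by rw [← this, h, e1]
      nlinarith
  · have := hS h
    exact ⟨by omega, this.2⟩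
  · rcases hcases with h' | h' | h'
    · have := hO h'
      rw [h.1, e2] at this
      nlinarith
    · exact h'
    · have := hU h'
      have h2 : (m + 1) * (m + 2) = 2 * (m + 1) ^ 2 := by rw [← this, h.1, e2]
      -- n(n+1)/2 = n² only for n = 1, which is odd. The same coincidence returns in the unitary
      -- case.
      have h3 : m = 0 := by nlinarith
      subst h3
      exact absurd h.2 (by decide)
  · rcases hcases with h' | h' | h'
    · have := hO h'
      rw [h] at this
      nlinarith
    · have := hS h'
      rw [h] at this
      have h3 : m = 0 := by nlinarith
      subst h3
      exact absurd this.2 (by decide)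
    · exact h'

end SimpleInvolution
-- Permutation of the factors of a product by an involution
section Factors

variable {ι : Type*} {A : ι → Type*} [∀ i, Ring (A i)] {s : RingInvo (∀ i, A i)}

open Classical in
theorem mem_factor_iff {i : ι} {x : ∀ i, A i} : x ∈ factor A i ↔ Pi.single i 1 * x = x := by
  constructor
  · intro hx
    funext j
    by_cases hj : j = i
    · subst hj; simp
    · simp [hx j hj]
  · intro h j hj
    rw [← h]
    simp [hj]

open Classical in
theorem single_one_mul_comm (i : ι) (x : ∀ i, A i) :
    Pi.single i 1 * x = x * Pi.single i 1 := by
  funext j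
  by_cases hj : j = i
  · subst hj; simp
  · simp [hj]

open Classical in
theorem maps_of_app_single {i j : ι}
    (h : app s (Pi.single i 1) = Pi.single j 1) : Maps s i j := by
  have h' : app s (Pi.single j 1) = Pi.single i 1 := by rw [← h, app_app]
  ext y
  constructor
  · rintro ⟨x, hx, rfl⟩
    rw [mem_factor_iff] at hx ⊢
    conv_rhs => rw [← hx]
    rw [app_mul, h, single_one_mul_comm]
  · intro hy
    refine ⟨app s y, ?_, app_app s y⟩
    rw [mem_factor_iff] at hy ⊢
    conv_rhs => rw [← hy]
    rw [app_mul, h', single_one_mul_comm]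

theorem Maps.eq_right [∀ i, Nontrivial (A i)] {i j k : ι} (h : Maps s i j) (h' : Maps s i k) :
    j = k := by
  classical
  have hm : (Pi.single j 1 : ∀ i, A i) ∈ factor A k := h' ▸ h ▸ single_mem_factor j 1
  by_contra hjk
  simpa using hm j hjk

/-- An idempotent of a field-like centre is trivial. -/
theorem eq_zero_or_one_of_central_idem {R : Type*} [Ring R] [IsSimpleRing R] {e : R}
    (he : e ∈ Subring.center R) (hee : e * e = e) : e = 0 ∨ e = 1 := by
  let := centerField R
  have h : (⟨e, he⟩ : Subring.center R) * ⟨e, he⟩ = ⟨e, he⟩ := Subtype.ext hee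
  rcases eq_or_ne (⟨e, he⟩ : Subring.center R) 0 with h0 | h0
  · exact Or.inl (congrArg Subtype.val h0)
  · exact Or.inr (congrArg Subtype.val (mul_left_cancel₀ h0 (h.trans (mul_one _).symm)))

/-- An involution of a product of simple rings permutes the factors. -/
theorem existsUnique_maps [∀ i, IsSimpleRing (A i)] (s : RingInvo (∀ i, A i)) (i : ι) :
    ∃! j, Maps s i j := by
  classical
  have hval : ∀ i j, app s (Pi.single i 1) j = 0 ∨ app s (Pi.single i 1) j = 1 := by
    intro i j
    apply eq_zero_or_one_of_central_idem
    · refine Subring.mem_center_iff.2 fun a => ?_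
      have h := congrArg (app s) (single_one_mul_comm i (app s (Pi.single j a)))
      rw [app_mul, app_mul, app_app] at h
      simpa using congrFun h j
    · have h : app s (Pi.single i 1 * Pi.single i 1) j = app s (Pi.single i 1) j := by
        rw [← Pi.single_mul, one_mul]
      rwa [app_mul] at h
  -- If σ(e_i) has j-component 1, then e_j σ(e_i) = e_j; applying σ shows that σ(e_j) is supported
  -- at i. Being nonzero there, it must be e_i.
  have hmul : ∀ i j, app s (Pi.single i 1) j = 1 →
      app s (Pi.single j 1) = Pi.single i 1 * app s (Pi.single j 1) := by
    intro i j h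
    have h1 : (Pi.single j 1 : ∀ i, A i) * app s (Pi.single i 1) = Pi.single j 1 := by
      funext k
      by_cases hk : k = j
      · subst hk; simp [h]
      · simp [hk]
    conv_lhs => rw [← h1, app_mul, app_app]
  have hne : ∀ i, ∃ j, app s (Pi.single i 1) j = 1 := by
    intro i
    by_contra! h
    have h0 : app s (Pi.single i 1) = 0 := funext fun j => (hval i j).resolve_right (h j)
    have h1 := app_app s (Pi.single i 1)
    rw [h0, app_zero] at h1
    have h2 := (congrFun h1 i).symm
    simp at h2
  obtain ⟨j, hj⟩ := hne i
  have h1 : app s (Pi.single j 1) = Pi.single i 1 := by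
    have h2 := hmul i j hj
    obtain ⟨k, hk⟩ := hne j
    have hki : k = i := by
      by_contra hki
      have := congrFun h2 k
      rw [hk] at this
      simp [hki] at this
    subst hki
    rw [h2]
    funext l
    by_cases hl : l = k
    · subst hl; simp [hk]
    · simp [hl]
  have hM : Maps s i j := (maps_of_app_single h1).symm
  exact ⟨j, hM, fun k hk => hk.eq_right hM⟩

open Classical in
/-- The component of `s x` at `j` depends only on the component of `x` at `i`. -/
theorem Maps.app_apply {i j : ι} (h : Maps s i j) (x : ∀ i, A i) :
    app s x j = app s (Pi.single i (x i)) j := by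
  -- σ(e_j) is supported at i, so it is annihilated by r; applying σ kills the j-component of σ r.
  have hr : ∀ r : ∀ i, A i, r i = 0 → app s r j = 0 := by
    intro r hr
    have h1 := h.symm.mem (single_mem_factor j 1)
    have h2 : r * app s (Pi.single j 1) = 0 := by
      funext k
      by_cases hk : k = i
      · subst hk; simp [hr]
      · simp [h1 k hk]
    have h3 := congrArg (app s) h2
    rw [app_mul, app_app, app_zero] at h3
    simpa using congrFun h3 j
  have h1 := hr (x - Pi.single i (x i)) (by simp)
  rw [sub_eq_add_neg, app_add, app_neg] at h1
  exact add_neg_eq_zero.1 h1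

open Classical in
/-- The restriction of `s` to a map between two factors. -/
noncomputable def factorMap (s : RingInvo (∀ i, A i)) (i j : ι) (a : A i) : A j :=
  app s (Pi.single i a) j

theorem factorMap_add (i j : ι) (a b : A i) :
    factorMap s i j (a + b) = factorMap s i j a + factorMap s i j b := by
  simp [factorMap, Pi.single_add, app_add]

theorem factorMap_mul (i j : ι) (a b : A i) :
    factorMap s i j (a * b) = factorMap s i j b * factorMap s i j a := by
  simp [factorMap, Pi.single_mul, app_mul]

theorem factorMap_neg (i j : ι) (a : A i) : factorMap s i j (-a) = -factorMap s i j a := by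
  simp [factorMap, Pi.single_neg, app_neg]

theorem Maps.factorMap_factorMap {i j : ι} (h : Maps s i j) (a : A i) :
    factorMap s j i (factorMap s i j a) = a := by
  classical
  unfold factorMap
  rw [single_apply_of_mem_factor (h.mem (single_mem_factor i a)), app_app]
  simp

theorem Maps.app_eq {i j : ι} (h : Maps s i j) (x : ∀ i, A i) :
    app s x j = factorMap s i j (x i) := h.app_apply x

theorem app_blockInvo {i : ι} (h : Maps s i i) (a : A i) :
    app (blockInvo s h) a = factorMap s i i a := rfl

theorem app_pairInvo {i j : ι} (h : Maps s i j) (a : A i × A j) :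
    app (pairInvo s h) a = (factorMap s j i a.2, factorMap s i j a.1) := rfl

theorem Maps.factorMap_mem_center {i j : ι} (h : Maps s i j) {z : A i}
    (hz : z ∈ Subring.center (A i)) : factorMap s i j z ∈ Subring.center (A j) := by
  refine Subring.mem_center_iff.2 fun b => ?_
  rw [← h.symm.factorMap_factorMap b, ← factorMap_mul, ← factorMap_mul,
    Subring.mem_center_iff.1 hz]

/-- Factors exchanged by an involution are opposite to each other. -/
noncomputable def Maps.ringEquiv {i j : ι} (h : Maps s i j) : A j ≃+* (A i)ᵐᵒᵖ where
  toFun b := MulOpposite.op (factorMap s j i b)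
  invFun a := factorMap s i j a.unop
  left_inv b := h.symm.factorMap_factorMap b
  right_inv a := by simp [h.factorMap_factorMap]
  map_mul' a b := by simp [factorMap_mul]
  map_add' a b := by simp [factorMap_add]

theorem Maps.centerDim_eq {i j : ι} (h : Maps s i j) : centerDim (A j) = centerDim (A i) := by
  refine centerDim_eq_of_equiv
    (fun z => ⟨factorMap s j i z, h.symm.factorMap_mem_center z.2⟩)
    { toFun := factorMap s j i
      invFun := factorMap s i j
      left_inv := h.symm.factorMap_factorMap
      right_inv := h.factorMap_factorMap
      map_add' := factorMap_add j i } ⟨fun x y hxy => ?_, fun z => ?_⟩ fun r m => ?_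
  · have := congrArg (fun z : Subring.center (A i) => factorMap s i j z) hxy
    simpa [h.symm.factorMap_factorMap] using this
  · exact ⟨⟨factorMap s i j z, h.factorMap_mem_center z.2⟩,
      Subtype.ext (h.factorMap_factorMap z.1)⟩
  · change factorMap s j i (r * m) = factorMap s j i r * factorMap s j i m
    rw [factorMap_mul, Subring.mem_center_iff.1 (h.symm.factorMap_mem_center r.2)]

theorem Prod.mem_center_iff {R S : Type*} [Ring R] [Ring S] {x : R × S} :
    x ∈ Subring.center (R × S) ↔ x.1 ∈ Subring.center R ∧ x.2 ∈ Subring.center S := by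
  simp only [Subring.mem_center_iff]
  constructor
  · intro h
    exact ⟨fun a => congrArg _root_.Prod.fst (h (a, 0)), fun b => congrArg _root_.Prod.snd (h (0, b))⟩
  · rintro ⟨h1, h2⟩ ⟨a, b⟩
    exact _root_.Prod.ext (h1 a) (h2 b)

/-- F is the graph of σ over the centre of the first factor, since the second coordinate of a
symmetric element is forced by the first. -/
theorem Maps.mem_symCenter_iff {i j : ι} (h : Maps s i j) {z : A i × A j} :
    z ∈ symCenter (pairInvo s h) ↔ z.1 ∈ Subring.center (A i) ∧ z.2 = factorMap s i j z.1 := by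
  change (z ∈ Subring.center (A i × A j) ∧ app (pairInvo s h) z = z) ↔ _
  rw [Prod.mem_center_iff, app_pairInvo, _root_.Prod.ext_iff]
  constructor
  · rintro ⟨⟨h1, -⟩, -, h2⟩
    exact ⟨h1, h2.symm⟩
  · rintro ⟨h1, h2⟩
    refine ⟨⟨h1, h2 ▸ h.factorMap_mem_center h1⟩, ?_, h2.symm⟩
    simp [h2, h.factorMap_factorMap]

/-- The two coordinate equations are equivalent because σ is involutive, so a skew pair is freely
determined by its first coordinate. -/
theorem Maps.pair_skew_iff {i j : ι} (h : Maps s i j) {z : A i × A j} :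
    app (pairInvo s h) z = -z ↔ z.2 = -factorMap s i j z.1 := by
  rw [app_pairInvo, _root_.Prod.ext_iff]
  constructor
  · rintro ⟨-, h2⟩
    simp only [Prod.snd_neg] at h2
    rw [h2, neg_neg]
  · intro h2
    simp [h2, factorMap_neg, h.factorMap_factorMap]

theorem Maps.bijOn_fst_symCenter {i j : ι} (h : Maps s i j) :
    Set.BijOn Prod.fst {z | z ∈ symCenter (pairInvo s h)} {z | z ∈ Subring.center (A i)} := by
  refine ⟨fun z hz => (h.mem_symCenter_iff.1 hz).1, fun z hz w hw hzw => ?_, fun a ha => ?_⟩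
  · refine _root_.Prod.ext hzw ?_
    rw [(h.mem_symCenter_iff.1 hz).2, (h.mem_symCenter_iff.1 hw).2, hzw]
  · exact ⟨(a, factorMap s i j a), h.mem_symCenter_iff.2 ⟨ha, rfl⟩, rfl⟩

theorem Maps.skewDim_pairInvo {i j : ι} (h : Maps s i j) :
    skewDim (pairInvo s h) = centerDim (A i) := by
  have hbij := h.bijOn_fst_symCenter
  refine skewDim_eq_finrank _ (fun z => ⟨z.1.1, hbij.mapsTo z.2⟩)
    { toFun := fun x => x.1.1
      invFun := fun a => ⟨(a, -factorMap s i j a), h.pair_skew_iff.2 rfl⟩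
      left_inv := fun x => Subtype.ext (_root_.Prod.ext rfl (h.pair_skew_iff.1 x.2).symm)
      right_inv := fun a => rfl
      map_add' := fun x y => rfl } ⟨fun z w hzw => ?_, fun a => ?_⟩ fun r m => rfl
  · exact Subtype.ext (hbij.injOn z.2 w.2 (congrArg Subtype.val hzw))
  · obtain ⟨z, hz, hza⟩ := hbij.surjOn a.2
    exact ⟨⟨z, hz⟩, Subtype.ext hza⟩

/-- The skew elements of an exchanged pair project isomorphically onto the first factor. -/
noncomputable def Maps.skewPairEquiv [∀ i, Algebra ℚ (A i)] {i j : ι} (h : Maps s i j) :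
    skew (pairInvo s h) ≃ₗ⁅ℚ⁆ A i where
  toFun x := x.1.1
  invFun a := ⟨(a, -factorMap s i j a), h.pair_skew_iff.2 rfl⟩
  left_inv x := Subtype.ext (_root_.Prod.ext rfl (h.pair_skew_iff.1 x.2).symm)
  right_inv _ := rfl
  map_add' _ _ := rfl
  map_smul' _ _ := rfl
  map_lie' := rfl

end Factors

/-! ### The Wedderburn decomposition through simple modules -/

section Wedderburn

variable {R : Type u} [Ring R]

/-- The endomorphism ring of a finite dimensional nonzero vector space is simple. -/
theorem isSimpleRing_end (K V : Type*) [DivisionRing K] [AddCommGroup V] [Module K V]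
    [Module.Finite K V] [Nontrivial V] : IsSimpleRing (Module.End K V) := by
  have : Nonempty (Fin (Module.finrank K V)) := Fin.pos_iff_nonempty.1 Module.finrank_pos
  -- Over a noncommutative K the matrix entries lie in End_K(K), which is the opposite ring of K.
  have h1 : IsSimpleRing (Module.End K K) :=
    IsSimpleRing.of_ringEquiv (RingEquiv.moduleEndSelf K) inferInstance
  have h2 : IsSimpleRing (Matrix (Fin (Module.finrank K V)) (Fin (Module.finrank K V))
    (Module.End K K)) := inferInstance
  have h3 := IsSimpleRing.of_ringEquiv
    (endVecRingEquivMatrixEnd (Fin (Module.finrank K V)) K K).symm h2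
  exact IsSimpleRing.of_ringEquiv (Module.finBasis K V).equivFun.symm.conjRingEquiv h3

/-- A simple module over a finite dimensional algebra is finite dimensional. -/
theorem finite_of_isSimpleModule (k : Type*) [Field k] [Algebra k R] [Module.Finite k R]
    (V : Type*) [AddCommGroup V] [Module R V] [Module k V] [IsScalarTower k R V]
    [IsSimpleModule R V] : Module.Finite k V :=
  Module.Finite.trans R V

/-- By Schur's lemma D is a division ring. It contains the scalars from k, so V is
finite-dimensional over D. -/
theorem isSimpleRing_endD (k : Type*) [Field k] [Algebra k R] [Module.Finite k R]
    (V : Type*) [AddCommGroup V] [Module R V] [Module k V] [IsScalarTower k R V]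
    [IsSimpleModule R V] : IsSimpleRing (EndD R V) := by
  classical
  have : Nontrivial V := IsSimpleModule.nontrivial R V
  have : Module.Finite k V := finite_of_isSimpleModule (R := R) k V
  have : SMulCommClass R k V := inferInstance
  have : Module.Finite (D R V) V := by
    obtain ⟨t, ht⟩ := Module.Finite.fg_top (R := k) (M := V)
    refine ⟨t, eq_top_iff.2 fun x _ => ?_⟩
    have hx : x ∈ Submodule.span k (t : Set V) := ht ▸ Submodule.mem_top
    induction hx using Submodule.span_induction with
    | mem x hx => exact Submodule.subset_span hx
    | zero => exact zero_mem _
    | add x y _ _ hx hy => exact add_mem (hx trivial) (hy trivial)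
    | smul c x _ hx =>
      have := Submodule.smul_mem _ (algebraMap k (D R V) c) (hx trivial)
      simpa using this
  exact isSimpleRing_end (D R V) V

variable {ι : Type*} {V : ι → Type u} [∀ i, AddCommGroup (V i)] [∀ i, Module R (V i)]

/-- A semisimple ring has finitely many simple modules. -/
theorem IsCompleteListOfSimples.finite [IsSemisimpleRing R] (hV : IsCompleteListOfSimples R V) :
    Finite ι := by
  have := hV.simple
  choose I hI using fun i => IsSemisimpleRing.exists_linearEquiv_ideal_of_isSimpleModule R (V i)
  have hs : ∀ i, IsSimpleModule R (I i) := fun i => IsSimpleModule.congr (hI i).some.symm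
  -- Each simple module embeds as a left ideal, and non-isomorphic ones have different isotypic
  -- components, of which there are finitely many.
  let f : ι → isotypicComponents R R := fun i => ⟨isotypicComponent R R (I i), I i, hs i, rfl⟩
  refine Finite.of_injective f fun i j hij => ?_
  have h1 : isotypicComponent R R (I i) = isotypicComponent R R (I j) := congrArg Subtype.val hij
  have h2 : I i ≤ isotypicComponent R R (I j) := h1 ▸ (I i).le_isotypicComponent
  obtain ⟨e⟩ := isIsotypicOfType_submodule_iff.mp (.isotypicComponent R R (I j)) _ h2
  exact hV.eq_of_iso i j ⟨(hI i).some.trans (e.trans (hI j).some.symm)⟩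

/-- R is the sum of its simple left ideals, each isomorphic to a listed module; so r kills R, in
particular 1. -/
theorem IsCompleteListOfSimples.eq_zero_of_smul [IsSemisimpleRing R]
    (hV : IsCompleteListOfSimples R V) {r : R} (hr : ∀ i (v : V i), r • v = 0) : r = 0 := by
  have h : ∀ x : R, x ∈ sSup {m : Submodule R R | IsSimpleModule R m} → r * x = 0 := by
    intro x hx
    rw [sSup_eq_iSup'] at hx
    induction hx using Submodule.iSup_induction' with
    | mem m x hx =>
      obtain ⟨i, ⟨e⟩⟩ := hV.complete m.1 m.2
      have h1 : r • (⟨x, hx⟩ : m.1) = 0 := by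
        apply e.injective
        rw [map_smul, hr, map_zero]
      exact congrArg Subtype.val h1
    | zero => exact mul_zero r
    | add x y _ _ hx hy => rw [mul_add, hx, hy, add_zero]
  simpa using h 1 (by rw [IsSemisimpleModule.sSup_simples_eq_top]; trivial)

/-- The action of `R` on a family of modules. -/
def actionHom (R : Type u) [Ring R] {ι : Type*} (V : ι → Type u) [∀ i, AddCommGroup (V i)]
    [∀ i, Module R (V i)] : R →+* ∀ i, EndD R (V i) :=
  RingHom.pi fun i => Module.toModuleEnd (D R (V i)) (S := R) (V i)

theorem IsCompleteListOfSimples.actionHom_injective [IsSemisimpleRing R]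
    (hV : IsCompleteListOfSimples R V) : Function.Injective (actionHom R V) :=
  (injective_iff_map_eq_zero _).2 fun _ hr => hV.eq_zero_of_smul fun i v =>
    LinearMap.congr_fun (congrFun hr i) v

theorem IsCompleteListOfSimples.actionHom_surjective [IsSemisimpleRing R] [Algebra ℚ R]
    [Module.Finite ℚ R] [∀ i, Module ℚ (V i)] [∀ i, IsScalarTower ℚ R (V i)]
    (hV : IsCompleteListOfSimples R V) : Function.Surjective (actionHom R V) := by
  classical
  intro f
  have := hV.finite
  have := Fintype.ofFinite ι
  have := hV.simple
  have := fun i => finite_of_isSimpleModule (R := R) ℚ (V i)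
  -- To apply density, f must commute with all R-endomorphisms of the product. By Schur's lemma
  -- these have no components between distinct V i, so they act diagonally.
  let F : Module.End (Module.End R (∀ i, V i)) (∀ i, V i) :=
    { toFun := fun m i => f i (m i)
      map_add' := fun m m' => by ext i; simp
      map_smul' := fun g m => by
        ext i
        have key : ∀ m : ∀ i, V i, g m i = g (Pi.single i (m i)) i := by
          intro m
          conv_lhs => rw [← Finset.univ_sum_single m, map_sum, Finset.sum_apply]
          refine Finset.sum_eq_single i (fun j _ hji => ?_) (fun h => absurd (Finset.mem_univ i) h)
          have h0 : (LinearMap.proj i ∘ₗ g ∘ₗ LinearMap.single R V j : V j →ₗ[R] V i) = 0 :=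
            (LinearMap.bijective_or_eq_zero _).resolve_left fun hb =>
              hji (hV.eq_of_iso j i ⟨LinearEquiv.ofBijective _ hb⟩)
          exact LinearMap.congr_fun h0 (m j)
        let d : D R (V i) := LinearMap.proj i ∘ₗ g ∘ₗ LinearMap.single R V i
        have hd : ∀ m : ∀ i, V i, g m i = d (m i) := key
        change f i (g m i) = g (fun i => f i (m i)) i
        rw [hd, hd]
        exact (f i).map_smul d (m i) }
  obtain ⟨t, ht⟩ := Module.Finite.fg_top (R := ℚ) (M := ∀ i, V i)
  obtain ⟨r, hr⟩ := jacobson_density (R := R) F t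
  refine ⟨r, ?_⟩
  have hall : ∀ m, F m = r • m := by
    intro m
    have hm : m ∈ Submodule.span ℚ (t : Set (∀ i, V i)) := ht ▸ Submodule.mem_top
    induction hm using Submodule.span_induction with
    | mem m hm => exact hr m hm
    | zero => simp
    | add x y _ _ hx hy => rw [map_add, hx, hy, smul_add]
    | smul c x _ hx => rw [map_rat_smul F, hx, smul_comm]
  funext i
  ext v
  have := congrFun (hall (Pi.single i v)) i
  have h : r • v = f i v := by simpa [F] using this.symm
  exact h

/-- The Wedderburn decomposition of a finite dimensional semisimple rational algebra. -/
noncomputable def IsCompleteListOfSimples.algEquiv [IsSemisimpleRing R] [Algebra ℚ R]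
    [Module.Finite ℚ R] [∀ i, Module ℚ (V i)] [∀ i, IsScalarTower ℚ R (V i)]
    (hV : IsCompleteListOfSimples R V) : R ≃ₐ[ℚ] ∀ i, EndD R (V i) :=
  AlgEquiv.ofBijective (actionHom R V).toRatAlgHom ⟨hV.actionHom_injective, hV.actionHom_surjective⟩

end Wedderburn

/-! ### Projections of skew elements to the blocks -/

section LieDecomposition

/-- An element of a finite direct sum with prescribed components. -/
theorem exists_directSum_eq {ι : Type*} [Finite ι] {M : ι → Type*} [∀ i, AddCommGroup (M i)]
    (f : ∀ i, M i) : ∃ x : ⨁ i, M i, ∀ i, x i = f i := by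
  have := Fintype.ofFinite ι
  exact ⟨DFinsupp.equivFunOnFintype.symm f, fun i => rfl⟩

/-- A family of morphisms to the summands of a finite direct sum of Lie algebras. -/
noncomputable def directSumLieHom {k L ι : Type*} [CommRing k] [LieRing L] [LieAlgebra k L]
    [Finite ι] {M : ι → Type*} [∀ i, LieRing (M i)] [∀ i, LieAlgebra k (M i)]
    (f : ∀ i, L →ₗ⁅k⁆ M i) : L →ₗ⁅k⁆ ⨁ i, M i where
  toFun x := (exists_directSum_eq fun i => f i x).choose
  map_add' x y := DFinsupp.ext fun i => by
    rw [DFinsupp.add_apply]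
    simp only [fun x => (exists_directSum_eq fun i => f i x).choose_spec i]
    exact (f i).map_add x y
  map_smul' c x := DFinsupp.ext fun i => by
    rw [DFinsupp.smul_apply]
    simp only [fun x => (exists_directSum_eq fun i => f i x).choose_spec i]
    exact (f i).map_smul c x
  map_lie' {x y} := DFinsupp.ext fun i => by
    erw [DirectSum.bracket_apply]
    simp only [fun x => (exists_directSum_eq fun i => f i x).choose_spec i]
    exact (f i).map_lie x y

theorem directSumLieHom_apply {k L ι : Type*} [CommRing k] [LieRing L] [LieAlgebra k L]
    [Finite ι] {M : ι → Type*} [∀ i, LieRing (M i)] [∀ i, LieAlgebra k (M i)]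
    (f : ∀ i, L →ₗ⁅k⁆ M i) (x : L) (i : ι) : directSumLieHom f x i = f i x :=
  (exists_directSum_eq fun i => f i x).choose_spec i

variable {R : Type*} [Ring R] [Algebra ℚ R] {ι : Type*} {A : ι → Type u} [∀ i, Ring (A i)]
  [∀ i, Algebra ℚ (A i)]

theorem app_transport {R S : Type*} [Ring R] [Ring S] (e : R ≃+* S) (σ : RingInvo R) (x : R) :
    app (transport e σ) (e x) = e (app σ x) := by
  change e (app σ (e.symm (e x))) = _
  rw [e.symm_apply_apply]

/-- An algebra homomorphism compatible with involutions restricts to skew elements. -/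
def skewHom {S : Type*} [Ring S] [Algebra ℚ S] (f : R →ₐ[ℚ] S) (σ : RingInvo R) (τ : RingInvo S)
    (h : ∀ x, app σ x = -x → app τ (f x) = -f x) : skew σ →ₗ⁅ℚ⁆ skew τ where
  toFun x := ⟨f x, h x x.2⟩
  map_add' x y := Subtype.ext (map_add f x.1 y.1)
  map_smul' c x := Subtype.ext (map_smul f c x.1)
  map_lie' {x y} := Subtype.ext <| by
    change f (x.1 * y.1 - y.1 * x.1) = f x.1 * f y.1 - f y.1 * f x.1
    rw [map_sub, map_mul, map_mul]

variable (Φ : R ≃ₐ[ℚ] ∀ i, A i) (σ : RingInvo R)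

/-- The projection of the skew elements to a stable factor. -/
noncomputable def skewToBlock {i : ι} (h : Maps (transport Φ.toRingEquiv σ) i i) :
    skew σ →ₗ⁅ℚ⁆ skew (blockInvo (transport Φ.toRingEquiv σ) h) :=
  skewHom ((Pi.evalAlgHom ℚ A i).comp Φ.toAlgHom) σ _ fun x hx => by
    rw [app_blockInvo]
    change factorMap (transport Φ.toRingEquiv σ) i i (Φ x i) = -(Φ x i)
    rw [← h.app_eq]
    have h1 := app_transport Φ.toRingEquiv σ x
    rw [hx] at h1
    exact (congrFun h1 i).trans (by simp)

/-- The projection of the skew elements to a pair of exchanged factors. -/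
noncomputable def skewToPair {i j : ι} (h : Maps (transport Φ.toRingEquiv σ) i j) :
    skew σ →ₗ⁅ℚ⁆ skew (pairInvo (transport Φ.toRingEquiv σ) h) :=
  skewHom (((Pi.evalAlgHom ℚ A i).comp Φ.toAlgHom).prod ((Pi.evalAlgHom ℚ A j).comp Φ.toAlgHom))
    σ _ fun x hx => by
    change (factorMap _ j i (Φ x j), factorMap _ i j (Φ x i)) = -(Φ x i, Φ x j)
    rw [← h.app_eq, ← h.symm.app_eq]
    have h1 := app_transport Φ.toRingEquiv σ x
    rw [hx] at h1
    exact _root_.Prod.ext ((congrFun h1 i).trans (by simp)) ((congrFun h1 j).trans (by simp))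

variable [Finite ι]

/-- The components of the skew elements in the four kinds of summands. -/
noncomputable def skewComponents (T : Set ι) : skew σ →ₗ⁅ℚ⁆
    (⨁ i : orthogonalSet (transport Φ.toRingEquiv σ), skew (blockInvo _ i.2.choose)) ×
    (⨁ i : symplecticSet (transport Φ.toRingEquiv σ), skew (blockInvo _ i.2.choose)) ×
    (⨁ i : unitarySet (transport Φ.toRingEquiv σ), skew (blockInvo _ i.2.choose)) ×
    (⨁ p : exchangedPairs (transport Φ.toRingEquiv σ) T, skew (pairInvo _ p.2.2.2)) :=
  LieHom.prod (directSumLieHom fun _ => skewToBlock Φ σ _) <|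
  LieHom.prod (directSumLieHom fun _ => skewToBlock Φ σ _) <|
  LieHom.prod (directSumLieHom fun _ => skewToBlock Φ σ _)
    (directSumLieHom fun _ => skewToPair Φ σ _)

theorem skewComponents_spec (T : Set ι) (x : skew σ) :
    (∀ i, ((skewComponents Φ σ T x).1 i).1 = Φ x i) ∧
    (∀ i, ((skewComponents Φ σ T x).2.1 i).1 = Φ x i) ∧
    (∀ i, ((skewComponents Φ σ T x).2.2.1 i).1 = Φ x i) ∧
    (∀ p, ((skewComponents Φ σ T x).2.2.2 p).1 = (Φ x p.1.1, Φ x p.1.2)) :=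
  ⟨fun i => congrArg Subtype.val (directSumLieHom_apply
      (fun i : orthogonalSet (transport Φ.toRingEquiv σ) => skewToBlock Φ σ i.2.choose) x i),
    fun i => congrArg Subtype.val (directSumLieHom_apply
      (fun i : symplecticSet (transport Φ.toRingEquiv σ) => skewToBlock Φ σ i.2.choose) x i),
    fun i => congrArg Subtype.val (directSumLieHom_apply
      (fun i : unitarySet (transport Φ.toRingEquiv σ) => skewToBlock Φ σ i.2.choose) x i),
    fun p => congrArg Subtype.val (directSumLieHom_apply
      (fun p : exchangedPairs (transport Φ.toRingEquiv σ) T => skewToPair Φ σ p.2.2.2) x p)⟩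

end LieDecomposition

/-! ### Every factor belongs to exactly one summand -/

section Types

variable {ι : Type*} {A : ι → Type u} [∀ i, Ring (A i)] {s : RingInvo (∀ i, A i)}

/-- The type does not depend on the chosen proof of stability, by proof irrelevance. -/
theorem mem_orthogonalSet_iff {i : ι} (h : Maps s i i) :
    i ∈ orthogonalSet s ↔ IsOrthogonalType (blockInvo s h) :=
  ⟨fun h' => h'.2, fun h' => ⟨h, h'⟩⟩

theorem mem_symplecticSet_iff {i : ι} (h : Maps s i i) :
    i ∈ symplecticSet s ↔ IsSymplecticType (blockInvo s h) :=
  ⟨fun h' => h'.2, fun h' => ⟨h, h'⟩⟩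

theorem mem_unitarySet_iff {i : ι} (h : Maps s i i) :
    i ∈ unitarySet s ↔ IsUnitaryType (blockInvo s h) :=
  ⟨fun h' => h'.2, fun h' => ⟨h, h'⟩⟩

variable [∀ i, Algebra ℚ (A i)] [∀ i, IsSimpleRing (A i)] [∀ i, Module.Finite ℚ (A i)]

/-- Both types together would give n² - n = n² + n with n > 0. -/
theorem not_orthogonal_and_symplectic {R : Type u} [Ring R] [IsSimpleRing R] [Algebra ℚ R]
    [Module.Finite ℚ R] {σ : RingInvo R} (hO : IsOrthogonalType σ) : ¬ IsSymplecticType σ := by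
  intro hS
  obtain ⟨n, hn0, hn⟩ := exists_centerDim_eq_sq R
  have h1 := IsAdjointOfSign.two_mul_skewDim hO hn
  have h2 := IsAdjointOfSign.two_mul_skewDim hS hn
  rw [h1] at h2
  omega

/-- A stable factor has exactly one type. -/
theorem type_trichotomy {i : ι} (h : Maps s i i) :
    (i ∈ orthogonalSet s ∧ i ∉ symplecticSet s ∧ i ∉ unitarySet s) ∨
    (i ∉ orthogonalSet s ∧ i ∈ symplecticSet s ∧ i ∉ unitarySet s) ∨
    (i ∉ orthogonalSet s ∧ i ∉ symplecticSet s ∧ i ∈ unitarySet s) := by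
  rw [mem_orthogonalSet_iff h, mem_symplecticSet_iff h, mem_unitarySet_iff h]
  by_cases h1 : IsFirstKind (blockInvo s h)
  · rcases h1.orthogonal_or_symplectic with h2 | h2
    · exact Or.inl ⟨h2, not_orthogonal_and_symplectic h2, fun h3 => h3 h1⟩
    · exact Or.inr (Or.inl ⟨fun h3 => not_orthogonal_and_symplectic h3 h2, h2, fun h3 => h3 h1⟩)
  · exact Or.inr (Or.inr ⟨fun h2 => h1 h2.1, fun h2 => h1 h2.1, h1⟩)

/-- Every factor lies in exactly one of the summands of the decomposition of the skew elements. -/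
theorem exists_component {T : Set ι} (hT : SelectsOne s T)
    (o : ∀ i : orthogonalSet s, skew (blockInvo s i.2.choose))
    (p : ∀ i : symplecticSet s, skew (blockInvo s i.2.choose))
    (u : ∀ i : unitarySet s, skew (blockInvo s i.2.choose))
    (q : ∀ p : exchangedPairs s T, skew (pairInvo s p.2.2.2)) (i : ι) :
    ∃ a : A i, (∀ h, (o ⟨i, h⟩).1 = a) ∧ (∀ h, (p ⟨i, h⟩).1 = a) ∧ (∀ h, (u ⟨i, h⟩).1 = a) ∧
      (∀ j h, (q ⟨(i, j), h⟩).1.1 = a) ∧ (∀ j h, (q ⟨(j, i), h⟩).1.2 = a) := by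
  obtain ⟨j, hj, -⟩ := existsUnique_maps s i
  by_cases hij : i = j
  · subst hij
    have hl : ∀ j, (i, j) ∉ exchangedPairs s T := fun j h => h.2.1 (hj.eq_right h.2.2)
    have hr : ∀ j, (j, i) ∉ exchangedPairs s T := fun j h => h.2.1 (h.2.2.symm.eq_right hj)
    rcases type_trichotomy hj with ⟨h1, h2, h3⟩ | ⟨h1, h2, h3⟩ | ⟨h1, h2, h3⟩
    · exact ⟨(o ⟨i, h1⟩).1, fun _ => rfl, fun h => absurd h h2, fun h => absurd h h3,
        fun j h => absurd h (hl j), fun j h => absurd h (hr j)⟩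
    · exact ⟨(p ⟨i, h2⟩).1, fun h => absurd h h1, fun _ => rfl, fun h => absurd h h3,
        fun j h => absurd h (hl j), fun j h => absurd h (hr j)⟩
    · exact ⟨(u ⟨i, h3⟩).1, fun h => absurd h h1, fun h => absurd h h2, fun _ => rfl,
        fun j h => absurd h (hl j), fun j h => absurd h (hr j)⟩
  · have hii : ¬ Maps s i i := fun h => hij (h.eq_right hj)
    have hj' : ∀ k, Maps s i k → k = j := fun k hk => hk.eq_right hj
    -- If i is the selected index, its component is the first coordinate of the pair; otherwise it
    -- is the second coordinate of the pair led by j.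
    rcases hT i j hij hj with ⟨hi, hjT⟩ | ⟨hjT, hi⟩
    · refine ⟨(q ⟨(i, j), hi, hij, hj⟩).1.1, fun h => absurd h.1 hii, fun h => absurd h.1 hii,
        fun h => absurd h.1 hii, fun k h => ?_, fun k h => ?_⟩
      · obtain rfl := hj' k h.2.2
        rfl
      · obtain rfl := hj' k h.2.2.symm
        exact absurd h.1 hjT
    · refine ⟨(q ⟨(j, i), hjT, Ne.symm hij, hj.symm⟩).1.2, fun h => absurd h.1 hii,
        fun h => absurd h.1 hii, fun h => absurd h.1 hii, fun k h => ?_, fun k h => ?_⟩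
      · exact absurd h.1 hi
      · obtain rfl := hj' k h.2.2.symm
        rfl

end Types

/-! ### Bijectivity of the decomposition -/

section LieDecomposition

variable {R : Type*} [Ring R] [Algebra ℚ R] {ι : Type*} {A : ι → Type u} [∀ i, Ring (A i)]
  [∀ i, Algebra ℚ (A i)] [∀ i, IsSimpleRing (A i)] [∀ i, Module.Finite ℚ (A i)] [Finite ι]
  (Φ : R ≃ₐ[ℚ] ∀ i, A i) (σ : RingInvo R) {T : Set ι}

theorem skewComponents_injective (hT : SelectsOne (transport Φ.toRingEquiv σ) T) :
    Function.Injective (skewComponents Φ σ T) := by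
  intro x y hxy
  obtain ⟨hx1, hx2, hx3, hx4⟩ := skewComponents_spec Φ σ T x
  obtain ⟨hy1, hy2, hy3, hy4⟩ := skewComponents_spec Φ σ T y
  rw [hxy] at hx1 hx2 hx3 hx4
  refine Subtype.ext (Φ.injective (funext fun i => ?_))
  obtain ⟨j, hj, -⟩ := existsUnique_maps (transport Φ.toRingEquiv σ) i
  by_cases hij : i = j
  · subst hij
    rcases type_trichotomy hj with ⟨h, -, -⟩ | ⟨-, h, -⟩ | ⟨-, -, h⟩
    · rw [← hx1 ⟨i, h⟩, hy1 ⟨i, h⟩]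
    · rw [← hx2 ⟨i, h⟩, hy2 ⟨i, h⟩]
    · rw [← hx3 ⟨i, h⟩, hy3 ⟨i, h⟩]
  · rcases hT i j hij hj with ⟨hi, -⟩ | ⟨hjT, -⟩
    · have h := (hx4 ⟨(i, j), hi, hij, hj⟩).symm.trans (hy4 ⟨(i, j), hi, hij, hj⟩)
      exact congrArg _root_.Prod.fst h
    · have h := (hx4 ⟨(j, i), hjT, Ne.symm hij, hj.symm⟩).symm.trans
        (hy4 ⟨(j, i), hjT, Ne.symm hij, hj.symm⟩)
      exact congrArg _root_.Prod.snd h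

theorem skewComponents_surjective (hT : SelectsOne (transport Φ.toRingEquiv σ) T) :
    Function.Surjective (skewComponents Φ σ T) := by
  rintro ⟨o, p, u, q⟩
  choose y hyo hyp hyu hyq hyq' using
    exists_component hT (fun i => o i) (fun i => p i) (fun i => u i) (fun i => q i)
  -- The component of σ y at j depends only on y at the partner i of j, so skewness can be read off
  -- in the one summand containing both.
  have hskew : app (transport Φ.toRingEquiv σ) y = -y := by
    funext j
    obtain ⟨i, hj, -⟩ := existsUnique_maps (transport Φ.toRingEquiv σ) j
    rw [hj.symm.app_eq, Pi.neg_apply]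
    by_cases hij : j = i
    · subst hij
      rcases type_trichotomy hj with ⟨h, -, -⟩ | ⟨-, h, -⟩ | ⟨-, -, h⟩
      · rw [← hyo j h]
        exact (o ⟨j, h⟩).2
      · rw [← hyp j h]
        exact (p ⟨j, h⟩).2
      · rw [← hyu j h]
        exact (u ⟨j, h⟩).2
    · rcases hT j i hij hj with ⟨hjT, -⟩ | ⟨hi, -⟩
      · have h := (q ⟨(j, i), hjT, hij, hj⟩).2
        rw [← hyq j i ⟨hjT, hij, hj⟩, ← hyq' i j ⟨hjT, hij, hj⟩]
        exact congrArg _root_.Prod.fst h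
      · have h := (q ⟨(i, j), hi, Ne.symm hij, hj.symm⟩).2
        rw [← hyq i j ⟨hi, Ne.symm hij, hj.symm⟩, ← hyq' j i ⟨hi, Ne.symm hij, hj.symm⟩]
        exact congrArg _root_.Prod.snd h
  have hx : app σ (Φ.symm y) = -Φ.symm y := by
    apply Φ.injective
    have h := app_transport Φ.toRingEquiv σ (Φ.symm y)
    have h2 : Φ.toRingEquiv (Φ.symm y) = y := Φ.apply_symm_apply y
    rw [h2, hskew] at h
    rw [map_neg, Φ.apply_symm_apply]
    exact h.symm
  refine ⟨⟨Φ.symm y, hx⟩, ?_⟩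
  obtain ⟨h1, h2, h3, h4⟩ := skewComponents_spec Φ σ T ⟨Φ.symm y, hx⟩
  simp only [Φ.apply_symm_apply] at h1 h2 h3 h4
  refine _root_.Prod.ext ?_ (_root_.Prod.ext ?_ (_root_.Prod.ext ?_ ?_))
  · exact DFinsupp.ext fun i => Subtype.ext ((h1 i).trans (hyo i.1 i.2).symm)
  · exact DFinsupp.ext fun i => Subtype.ext ((h2 i).trans (hyp i.1 i.2).symm)
  · exact DFinsupp.ext fun i => Subtype.ext ((h3 i).trans (hyu i.1 i.2).symm)
  · exact DFinsupp.ext fun p => Subtype.ext ((h4 p).trans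
      (_root_.Prod.ext (hyq p.1.1 p.1.2 p.2).symm (hyq' p.1.2 p.1.1 p.2).symm))

end LieDecomposition

end SkewGroupAlgebra

open SkewGroupAlgebra in
theorem theorem1p2 {G : Type u} [Group G] [Finite G] (σ : RingInvo (MonoidAlgebra ℚ G))
    {ι : Type*} (V : ι → Type u) [∀ i, AddCommGroup (V i)]
    [∀ i, Module (MonoidAlgebra ℚ G) (V i)] [∀ i, Module ℚ (V i)]
    [∀ i, IsScalarTower ℚ (MonoidAlgebra ℚ G) (V i)]
    (hV : IsCompleteListOfSimples (MonoidAlgebra ℚ G) V) :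
    Finite ι ∧
    -- the Wedderburn decomposition, given by the action on the simple modules
    ∃ Φ : MonoidAlgebra ℚ G ≃ₐ[ℚ] (∀ i, EndD (MonoidAlgebra ℚ G) (V i)),
      (∀ x i v, Φ x i v = x • v) ∧
    -- the degree of each block over its centre
    ∃ n : ι → ℕ,
      (∀ i, 0 < n i ∧ IsSimpleRing (EndD (MonoidAlgebra ℚ G) (V i)) ∧
        centerDim (EndD (MonoidAlgebra ℚ G) (V i)) = n i ^ 2) ∧
    ∃ s : RingInvo (∀ i, EndD (MonoidAlgebra ℚ G) (V i)),
      s = transport Φ.toRingEquiv σ ∧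
      -- `σ` permutes the blocks
      (∀ i, ∃! j, Maps s i j) ∧
      -- stable blocks: type and dimension of the skew part
      (∀ i (h : Maps s i i),
        (i ∈ orthogonalSet s ∨ i ∈ symplecticSet s ∨ i ∈ unitarySet s) ∧
        (i ∈ orthogonalSet s ↔ skewDim (blockInvo s h) = n i * (n i - 1) / 2) ∧
        (i ∈ symplecticSet s ↔
          skewDim (blockInvo s h) = n i * (n i + 1) / 2 ∧ Even (n i)) ∧
        (i ∈ unitarySet s ↔ skewDim (blockInvo s h) = n i ^ 2)) ∧
      -- exchanged pairs: degree, centre, dimension and structure of the skew part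
      (∀ i j (h : Maps s i j), i ≠ j →
        n j = n i ∧
        Nonempty (EndD (MonoidAlgebra ℚ G) (V j) ≃+* (EndD (MonoidAlgebra ℚ G) (V i))ᵐᵒᵖ) ∧
        Set.BijOn Prod.fst {z | z ∈ symCenter (pairInvo s h)}
          {z | z ∈ Subring.center (EndD (MonoidAlgebra ℚ G) (V i))} ∧
        skewDim (pairInvo s h) = n i ^ 2 ∧
        ∃ e : skew (pairInvo s h) ≃ₗ⁅ℚ⁆ EndD (MonoidAlgebra ℚ G) (V i),
          ∀ x, e x = (x : EndD (MonoidAlgebra ℚ G) (V i) × EndD (MonoidAlgebra ℚ G) (V j)).1) ∧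
      -- the decomposition of the Lie algebra of skew-symmetric elements
      ∀ T : Set ι, SelectsOne s T →
        ∃ Ψ : skew σ ≃ₗ⁅ℚ⁆
            (⨁ i : orthogonalSet s, skew (blockInvo s i.2.choose)) ×
            (⨁ i : symplecticSet s, skew (blockInvo s i.2.choose)) ×
            (⨁ i : unitarySet s, skew (blockInvo s i.2.choose)) ×
            (⨁ p : exchangedPairs s T, skew (pairInvo s p.2.2.2)),
          ∀ x : skew σ,
            (∀ i, ((Ψ x).1 i).1 = Φ x i) ∧
            (∀ i, ((Ψ x).2.1 i).1 = Φ x i) ∧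
            (∀ i, ((Ψ x).2.2.1 i).1 = Φ x i) ∧
            (∀ p, ((Ψ x).2.2.2 p).1 = (Φ x p.1.1, Φ x p.1.2)) := by
  have := hV.simple
  -- Semisimplicity of ℚG (Maschke) enters here, through instance search.
  have hfin := hV.finite
  refine ⟨hfin, ?_⟩
  have hsimple := fun i => isSimpleRing_endD (R := MonoidAlgebra ℚ G) ℚ (V i)
  -- Each block is a quotient of ℚG.
  have hdim : ∀ i, Module.Finite ℚ (EndD (MonoidAlgebra ℚ G) (V i)) := fun i =>
    Module.Finite.of_surjective
      ((Pi.evalAlgHom ℚ (fun i => EndD (MonoidAlgebra ℚ G) (V i)) i).comp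
        hV.algEquiv.toAlgHom).toLinearMap
      ((Function.surjective_eval i).comp hV.algEquiv.surjective)
  choose n hn0 hn using fun i => exists_centerDim_eq_sq (EndD (MonoidAlgebra ℚ G) (V i))
  refine ⟨hV.algEquiv, fun x i v => rfl, n, fun i => ⟨hn0 i, hsimple i, hn i⟩,
    transport hV.algEquiv.toRingEquiv σ, rfl, existsUnique_maps _, fun i h => ?_,
    fun i j h hij => ?_, fun T hT => ?_⟩
  · rw [mem_orthogonalSet_iff h, mem_symplecticSet_iff h, mem_unitarySet_iff h]
    exact type_iff_skewDim _ (hn0 i) (hn i)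
  · refine ⟨?_, ⟨h.ringEquiv⟩, h.bijOn_fst_symCenter, h.skewDim_pairInvo.trans (hn i),
      h.skewPairEquiv, fun x => rfl⟩
    refine Nat.pow_left_injective two_ne_zero ?_
    change n j ^ 2 = n i ^ 2
    rw [← hn, ← hn, h.centerDim_eq]
  · exact ⟨LieEquiv.ofBijective (skewComponents hV.algEquiv σ T)
      ⟨skewComponents_injective _ _ hT, skewComponents_surjective _ _ hT⟩,
      fun x => skewComponents_spec hV.algEquiv σ T x⟩
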